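/- Let $q\colon A\to M$ be a smooth real vector bundle of finite rank over a smooth finite-dimensional manifold (without boundary). Write $p_N\colon TN\to N$ for the tangent bundle of a manifold $N$ and $p=p_M$. For a vector bundle $D\to B$, the tangent prolongation $TD\to TB$ is the vector bundle whose projection, zero section, addition and scalar multiplication are the tangent maps of those of $D\to B$. Let $J_N\colon T^2N\to T^2N$ be the canonical involution of $N$, which is $(x,a;b,c)\mapsto(x,b;a,c)$ in the coordinates of $T^2N$ induced by a chart of $N$. Consider the cube of vector bundles with total space $T^2A$, projections $p_{TA}\colon T^2A\to TA$, $T(p_A)\colon T^2A\to TA$, $T^2(q)\colon T^2A\to T^2M$, and faces (listed as total space; two side bundles; base) - Up: $T^2A;\ TA$ (by $T(p_A)$), $T^2M$ (by $T^2(q)$); $TM$, where $TA\to TM$ is $T(q)$ and $T^2M\to TM$ is $T(p)$; - Back: $T^2A;\ TA$ (by $p_{TA}$), $T^2M$ (by $T^2(q)$); $TM$, where $TA\to TM$ is $T(q)$ and $T^2M\to TM$ is $p_{TM}$; - Left: $T^2A;\ TA$ (by $p_{TA}$), $TA$ (by $T(p_A)$); $A$, where both maps $TA\to A$ are $p_A$;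 - Right: $T^2M;\ TM$ (by $p_{TM}$), $TM$ (by $T(p)$); $M$, where both maps $TM\to M$ are $p$; - Down and Front: two copies of $TA;\ A$ (by $p_A$), $TM$ (by $T(q)$); $M$; the total space of Down is the base of $p_{TA}$, that of Front is the base of $T(p_A)$. The flipped cube is the same cube with the structures $p_{TA}$ and $T(p_A)$ on $T^2A$, the structures $p_{TM}$ and $T(p)$ on $T^2M$, and correspondingly the two copies of $TA$ and the two copies of $TM$, exchanged. A morphism of such cubes (or of squares) consists of smooth maps of all corners that are vector bundle morphisms along all edges; an isomorphism is a morphism with an inverse morphism. Then all faces of the cube and of the flipped cube are double vector bundles, and $J_A$ is an isomorphism of triple vector bundles from the cube onto the flipped cube; the maps of the other corners are $J_M$ on $T^2M$ and the identity on both copies of $TA$, both copies of $TM$, $A$ and $M$. In particular $J_A$ interchanges the Up and Back faces and interchanges the Front and Down faces (that is, it induces isomorphisms of double vector bundles Up $\to$ Back, Back $\to$ Up, Front $\to$ Down, Down $\to$ Front), and maps the Left face to its flip and, as $J_M$, the Right face to its flip. The core of the Left face, i.e. the set of elements of $T^2A$ that both $p_{TA}$ and $T(p_A)$ map to zero vectors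 of $p_A\colon TA\to A$, is identified with $TA$ by $\xi\mapsto \frac{d}{dt}(t\xi)\big|_{t=0}$ (scalar multiplication in $p_A$), and $J_A$ is the identity on it. -/

import Mathlib

open Set Bundle Manifold
open scoped ContDiff Topology

noncomputable section

/-! ## Vector bundle structures given by their operations -/

/-- The operations of a vector bundle structure on a manifold `D` with base a manifold `B`.
`add d d'` is the sum in the fibre and is meaningful only if `proj d = proj d'`; the other values
are junk and are never used. The laws are in `VBStr.IsVectorBundle`. -/
structure VBStr
    {XD : Type*} [NormedAddCommGroup XD] [NormedSpace ℝ XD] {HD : Type*} [TopologicalSpace HD]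
    (ID : ModelWithCorners ℝ XD HD) (D : Type*) [TopologicalSpace D] [ChartedSpace HD D]
    {XB : Type*} [NormedAddCommGroup XB] [NormedSpace ℝ XB] {HB : Type*} [TopologicalSpace HB]
    (IB : ModelWithCorners ℝ XB HB) (B : Type*) [TopologicalSpace B] [ChartedSpace HB B] where
  proj : D → B
  zero : B → D
  add : D → D → D
  smul : ℝ → D → D

namespace VBStr

section Basic

variable
  {XD : Type*} [NormedAddCommGroup XD] [NormedSpace ℝ XD] {HD : Type*} [TopologicalSpace HD]
  {ID : ModelWithCorners ℝ XD HD} {D : Type*} [TopologicalSpace D] [ChartedSpace HD D]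
  {XB : Type*} [NormedAddCommGroup XB] [NormedSpace ℝ XB] {HB : Type*} [TopologicalSpace HB]
  {IB : ModelWithCorners ℝ XB HB} {B : Type*} [TopologicalSpace B] [ChartedSpace HB B]
variable
  {XD' : Type*} [NormedAddCommGroup XD'] [NormedSpace ℝ XD'] {HD' : Type*} [TopologicalSpace HD']
  {ID' : ModelWithCorners ℝ XD' HD'} {D' : Type*} [TopologicalSpace D'] [ChartedSpace HD' D']
  {XB' : Type*} [NormedAddCommGroup XB'] [NormedSpace ℝ XB'] {HB' : Type*} [TopologicalSpace HB']
  {IB' : ModelWithCorners ℝ XB' HB'} {B' : Type*} [TopologicalSpace B'] [ChartedSpace HB' B']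

/-- The operations satisfy the laws of a smooth vector bundle of finite rank: locally on the base
there is a diffeomorphism `proj ⁻¹' U ≃ U × ℝⁿ` over `U`, `d ↦ (proj d, φ d)`, with inverse `ψ`, that
carries the operations to those of the vector space `ℝⁿ`. -/
structure IsVectorBundle (V : VBStr ID D IB B) : Prop where
  contMDiff_proj : ContMDiff ID IB ∞ V.proj
  proj_zero : ∀ b, V.proj (V.zero b) = b
  proj_add : ∀ d d', V.proj d = V.proj d' → V.proj (V.add d d') = V.proj d
  proj_smul : ∀ (t : ℝ) d, V.proj (V.smul t d) = V.proj d
  locally_trivial : ∀ b₀ : B, ∃ (U : Set B) (n : ℕ) (φ : D → (Fin n → ℝ))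
    (ψ : B × (Fin n → ℝ) → D), IsOpen U ∧ b₀ ∈ U ∧
      ContMDiffOn ID 𝓘(ℝ, Fin n → ℝ) ∞ φ (V.proj ⁻¹' U) ∧
      ContMDiffOn (IB.prod 𝓘(ℝ, Fin n → ℝ)) ID ∞ ψ (U ×ˢ univ) ∧
      (∀ b ∈ U, ∀ f, V.proj (ψ (b, f)) = b ∧ φ (ψ (b, f)) = f) ∧
      (∀ d, V.proj d ∈ U → ψ (V.proj d, φ d) = d) ∧
      (∀ b ∈ U, φ (V.zero b) = 0) ∧
      (∀ d d', V.proj d ∈ U → V.proj d = V.proj d' → φ (V.add d d') = φ d + φ d') ∧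
      (∀ (t : ℝ) d, V.proj d ∈ U → φ (V.smul t d) = t • φ d)

/-- `(Φ, φ)` is a smooth morphism of vector bundles. -/
structure IsHom (V : VBStr ID D IB B) (V' : VBStr ID' D' IB' B') (Φ : D → D') (φ : B → B') :
    Prop where
  contMDiff_total : ContMDiff ID ID' ∞ Φ
  contMDiff_base : ContMDiff IB IB' ∞ φ
  map_proj : ∀ d, V'.proj (Φ d) = φ (V.proj d)
  map_zero : ∀ b, Φ (V.zero b) = V'.zero (φ b)
  map_add : ∀ d d', V.proj d = V.proj d' → Φ (V.add d d') = V'.add (Φ d) (Φ d')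
  map_smul : ∀ (t : ℝ) d, Φ (V.smul t d) = V'.smul t (Φ d)

/-- The tangent prolongation `T(q) : TD → TB` of a vector bundle `q : D → B`: all the operations are
obtained by applying the tangent functor to those of `D`.

The sum of `v ∈ T_d D` and `w ∈ T_{d'} D` with `T(q) v = T(q) w` is the value on `(v, w)` of the
derivative of the addition `D ×_B D → D`; here `D ×_B D` is the set `{p | q p.1 = q p.2}`, and
`(v, w)` is tangent to it, so that the value of the derivative within this set on `(v, w)` is
determined. -/
def tangent [IsManifold ID 1 D] [IsManifold IB 1 B] (V : VBStr ID D IB B) :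
    VBStr ID.tangent (TangentBundle ID D) IB.tangent (TangentBundle IB B) where
  proj := tangentMap ID IB V.proj
  zero := tangentMap IB ID V.zero
  add v w := tangentMapWithin (ID.prod ID) ID (fun p : D × D ↦ V.add p.1 p.2)
    {p : D × D | V.proj p.1 = V.proj p.2} ((equivTangentBundleProd ID D ID D).symm (v, w))
  smul t := tangentMap ID ID (V.smul t)

open Classical in
/-- The vector bundle structure of a Mathlib vector bundle with fibres `W b` and model fibre `F`. -/
def ofBundle (IB : ModelWithCorners ℝ XB HB) (F : Type*) [NormedAddCommGroup F] [NormedSpace ℝ F]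
    (W : B → Type*) [TopologicalSpace (TotalSpace F W)] [∀ b, AddCommGroup (W b)]
    [∀ b, Module ℝ (W b)] [∀ b, TopologicalSpace (W b)] [FiberBundle F W] :
    VBStr (IB.prod 𝓘(ℝ, F)) (TotalSpace F W) IB B where
  proj := TotalSpace.proj
  zero b := ⟨b, 0⟩
  add v w := if h : w.proj = v.proj then ⟨v.proj, v.2 + h ▸ w.2⟩ else v
  smul t v := ⟨v.proj, t • v.2⟩

/-- The tangent bundle `p : TB → B`, with its usual vector bundle structure. -/
abbrev tangentBundle (IB : ModelWithCorners ℝ XB HB) (B : Type*) [TopologicalSpace B]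
    [ChartedSpace HB B] [IsManifold IB 1 B] : VBStr IB.tangent (TangentBundle IB B) IB B :=
  ofBundle IB XB (TangentSpace IB : B → Type _)

end Basic

end VBStr

/-! ## Squares of vector bundles and double vector bundles -/

/-- A square of vector bundle structures: `D` over `A` and over `B`, and both over `M`. -/
structure VBSquare
    {XD : Type*} [NormedAddCommGroup XD] [NormedSpace ℝ XD] {HD : Type*} [TopologicalSpace HD]
    (ID : ModelWithCorners ℝ XD HD) (D : Type*) [TopologicalSpace D] [ChartedSpace HD D]
    {XA : Type*} [NormedAddCommGroup XA] [NormedSpace ℝ XA] {HA : Type*} [TopologicalSpace HA]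
    (IA : ModelWithCorners ℝ XA HA) (A : Type*) [TopologicalSpace A] [ChartedSpace HA A]
    {XB : Type*} [NormedAddCommGroup XB] [NormedSpace ℝ XB] {HB : Type*} [TopologicalSpace HB]
    (IB : ModelWithCorners ℝ XB HB) (B : Type*) [TopologicalSpace B] [ChartedSpace HB B]
    {XM : Type*} [NormedAddCommGroup XM] [NormedSpace ℝ XM] {HM : Type*} [TopologicalSpace HM]
    (IM : ModelWithCorners ℝ XM HM) (M : Type*) [TopologicalSpace M] [ChartedSpace HM M] where
  vDA : VBStr ID D IA A
  vDB : VBStr ID D IB B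
  vA : VBStr IA A IM M
  vB : VBStr IB B IM M

namespace VBSquare

section

variable
  {XD : Type*} [NormedAddCommGroup XD] [NormedSpace ℝ XD] {HD : Type*} [TopologicalSpace HD]
  {ID : ModelWithCorners ℝ XD HD} {D : Type*} [TopologicalSpace D] [ChartedSpace HD D]
  {XA : Type*} [NormedAddCommGroup XA] [NormedSpace ℝ XA] {HA : Type*} [TopologicalSpace HA]
  {IA : ModelWithCorners ℝ XA HA} {A : Type*} [TopologicalSpace A] [ChartedSpace HA A]
  {XB : Type*} [NormedAddCommGroup XB] [NormedSpace ℝ XB] {HB : Type*} [TopologicalSpace HB]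
  {IB : ModelWithCorners ℝ XB HB} {B : Type*} [TopologicalSpace B] [ChartedSpace HB B]
  {XM : Type*} [NormedAddCommGroup XM] [NormedSpace ℝ XM] {HM : Type*} [TopologicalSpace HM]
  {IM : ModelWithCorners ℝ XM HM} {M : Type*} [TopologicalSpace M] [ChartedSpace HM M]
variable
  {XD' : Type*} [NormedAddCommGroup XD'] [NormedSpace ℝ XD'] {HD' : Type*} [TopologicalSpace HD']
  {ID' : ModelWithCorners ℝ XD' HD'} {D' : Type*} [TopologicalSpace D'] [ChartedSpace HD' D']
  {XA' : Type*} [NormedAddCommGroup XA'] [NormedSpace ℝ XA'] {HA' : Type*} [TopologicalSpace HA']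
  {IA' : ModelWithCorners ℝ XA' HA'} {A' : Type*} [TopologicalSpace A'] [ChartedSpace HA' A']
  {XB' : Type*} [NormedAddCommGroup XB'] [NormedSpace ℝ XB'] {HB' : Type*} [TopologicalSpace HB']
  {IB' : ModelWithCorners ℝ XB' HB'} {B' : Type*} [TopologicalSpace B'] [ChartedSpace HB' B']
  {XM' : Type*} [NormedAddCommGroup XM'] [NormedSpace ℝ XM'] {HM' : Type*} [TopologicalSpace HM']
  {IM' : ModelWithCorners ℝ XM' HM'} {M' : Type*} [TopologicalSpace M'] [ChartedSpace HM' M']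

/-- The same square with the roles of the two side bundles exchanged. -/
def flip (S : VBSquare ID D IA A IB B IM M) : VBSquare ID D IB B IA A IM M where
  vDA := S.vDB
  vDB := S.vDA
  vA := S.vB
  vB := S.vA

/-- A square of vector bundles is a double vector bundle: the two structures on `D` commute (the
projections form a commuting square of vector bundle morphisms, and the interchange laws hold) and
the map `D → A ×_M B` formed by the projections is a surjective submersion. -/
structure IsDoubleVectorBundle (S : VBSquare ID D IA A IB B IM M) : Prop where
  isVectorBundle_DA : S.vDA.IsVectorBundle
  isVectorBundle_DB : S.vDB.IsVectorBundle
  isVectorBundle_A : S.vA.IsVectorBundle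
  isVectorBundle_B : S.vB.IsVectorBundle
  isHom_projB : S.vDA.IsHom S.vB S.vDB.proj S.vA.proj
  isHom_projA : S.vDB.IsHom S.vA S.vDA.proj S.vB.proj
  isHom_zeroA : S.vA.IsHom S.vDB S.vDA.zero S.vB.zero
  isHom_zeroB : S.vB.IsHom S.vDA S.vDB.zero S.vA.zero
  add_add : ∀ d₁ d₂ d₃ d₄, S.vDA.proj d₁ = S.vDA.proj d₂ → S.vDA.proj d₃ = S.vDA.proj d₄ →
    S.vDB.proj d₁ = S.vDB.proj d₃ → S.vDB.proj d₂ = S.vDB.proj d₄ →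
    S.vDB.add (S.vDA.add d₁ d₂) (S.vDA.add d₃ d₄) = S.vDA.add (S.vDB.add d₁ d₃) (S.vDB.add d₂ d₄)
  smulA_addB : ∀ (t : ℝ) d d', S.vDB.proj d = S.vDB.proj d' →
    S.vDA.smul t (S.vDB.add d d') = S.vDB.add (S.vDA.smul t d) (S.vDA.smul t d')
  smulB_addA : ∀ (t : ℝ) d d', S.vDA.proj d = S.vDA.proj d' →
    S.vDB.smul t (S.vDA.add d d') = S.vDA.add (S.vDB.smul t d) (S.vDB.smul t d')
  smul_smul : ∀ (s t : ℝ) d, S.vDA.smul s (S.vDB.smul t d) = S.vDB.smul t (S.vDA.smul s d)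
  surjective : ∀ a b, S.vA.proj a = S.vB.proj b → ∃ d, S.vDA.proj d = a ∧ S.vDB.proj d = b
  submersion : ∀ (d : D) (α : TangentBundle IA A) (β : TangentBundle IB B),
    α.proj = S.vDA.proj d → β.proj = S.vDB.proj d →
    tangentMap IA IM S.vA.proj α = tangentMap IB IM S.vB.proj β →
    ∃ δ : TangentBundle ID D, δ.proj = d ∧ tangentMap ID IA S.vDA.proj δ = α ∧
      tangentMap ID IB S.vDB.proj δ = β

/-- Morphisms of double vector bundles: smooth maps of the four corners which are morphisms of
vector bundles on the four edges. -/
structure IsHom (S : VBSquare ID D IA A IB B IM M) (S' : VBSquare ID' D' IA' A' IB' B' IM' M')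
    (fD : D → D') (fA : A → A') (fB : B → B') (fM : M → M') : Prop where
  isHom_DA : S.vDA.IsHom S'.vDA fD fA
  isHom_DB : S.vDB.IsHom S'.vDB fD fB
  isHom_A : S.vA.IsHom S'.vA fA fM
  isHom_B : S.vB.IsHom S'.vB fB fM

/-- Isomorphisms of double vector bundles: morphisms with an inverse morphism. -/
def IsIso (S : VBSquare ID D IA A IB B IM M) (S' : VBSquare ID' D' IA' A' IB' B' IM' M')
    (fD : D → D') (fA : A → A') (fB : B → B') (fM : M → M') : Prop :=
  IsHom S S' fD fA fB fM ∧ ∃ gD gA gB gM, IsHom S' S gD gA gB gM ∧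
    (Function.LeftInverse gD fD ∧ Function.RightInverse gD fD) ∧
    (Function.LeftInverse gA fA ∧ Function.RightInverse gA fA) ∧
    (Function.LeftInverse gB fB ∧ Function.RightInverse gB fB) ∧
    (Function.LeftInverse gM fM ∧ Function.RightInverse gM fM)

/-- The core of a double vector bundle: the elements that project to zeros under both bundle
projections. -/
def core (S : VBSquare ID D IA A IB B IM M) : Set D :=
  {d | ∃ m : M, S.vDA.proj d = S.vA.zero m ∧ S.vDB.proj d = S.vB.zero m}

end

end VBSquare

/-! ## Cubes of vector bundles and triple vector bundles -/

/-- A cube of vector bundle structures: the field `vI_J` is the structure of the corner with index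
set `I` over the corner with index set `J`, and `v1`, `v2`, `v3` are the structures over `M`. -/
structure VBCube
    {XE123 : Type*} [NormedAddCommGroup XE123] [NormedSpace ℝ XE123] {HE123 : Type*} [TopologicalSpace HE123]
    (IE123 : ModelWithCorners ℝ XE123 HE123) (E123 : Type*) [TopologicalSpace E123] [ChartedSpace HE123 E123]
    {XE12 : Type*} [NormedAddCommGroup XE12] [NormedSpace ℝ XE12] {HE12 : Type*} [TopologicalSpace HE12]
    (IE12 : ModelWithCorners ℝ XE12 HE12) (E12 : Type*) [TopologicalSpace E12] [ChartedSpace HE12 E12]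
    {XE13 : Type*} [NormedAddCommGroup XE13] [NormedSpace ℝ XE13] {HE13 : Type*} [TopologicalSpace HE13]
    (IE13 : ModelWithCorners ℝ XE13 HE13) (E13 : Type*) [TopologicalSpace E13] [ChartedSpace HE13 E13]
    {XE23 : Type*} [NormedAddCommGroup XE23] [NormedSpace ℝ XE23] {HE23 : Type*} [TopologicalSpace HE23]
    (IE23 : ModelWithCorners ℝ XE23 HE23) (E23 : Type*) [TopologicalSpace E23] [ChartedSpace HE23 E23]
    {XE1 : Type*} [NormedAddCommGroup XE1] [NormedSpace ℝ XE1] {HE1 : Type*} [TopologicalSpace HE1]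
    (IE1 : ModelWithCorners ℝ XE1 HE1) (E1 : Type*) [TopologicalSpace E1] [ChartedSpace HE1 E1]
    {XE2 : Type*} [NormedAddCommGroup XE2] [NormedSpace ℝ XE2] {HE2 : Type*} [TopologicalSpace HE2]
    (IE2 : ModelWithCorners ℝ XE2 HE2) (E2 : Type*) [TopologicalSpace E2] [ChartedSpace HE2 E2]
    {XE3 : Type*} [NormedAddCommGroup XE3] [NormedSpace ℝ XE3] {HE3 : Type*} [TopologicalSpace HE3]
    (IE3 : ModelWithCorners ℝ XE3 HE3) (E3 : Type*) [TopologicalSpace E3] [ChartedSpace HE3 E3]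
    {XM : Type*} [NormedAddCommGroup XM] [NormedSpace ℝ XM] {HM : Type*} [TopologicalSpace HM]
    (IM : ModelWithCorners ℝ XM HM) (M : Type*) [TopologicalSpace M] [ChartedSpace HM M] where
  v123_12 : VBStr IE123 E123 IE12 E12
  v123_13 : VBStr IE123 E123 IE13 E13
  v123_23 : VBStr IE123 E123 IE23 E23
  v12_1 : VBStr IE12 E12 IE1 E1
  v12_2 : VBStr IE12 E12 IE2 E2
  v13_1 : VBStr IE13 E13 IE1 E1
  v13_3 : VBStr IE13 E13 IE3 E3
  v23_2 : VBStr IE23 E23 IE2 E2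
  v23_3 : VBStr IE23 E23 IE3 E3
  v1 : VBStr IE1 E1 IM M
  v2 : VBStr IE2 E2 IM M
  v3 : VBStr IE3 E3 IM M

namespace VBCube

section

variable
  {XE123 : Type*} [NormedAddCommGroup XE123] [NormedSpace ℝ XE123] {HE123 : Type*} [TopologicalSpace HE123]
  {IE123 : ModelWithCorners ℝ XE123 HE123} {E123 : Type*} [TopologicalSpace E123] [ChartedSpace HE123 E123]
  {XE12 : Type*} [NormedAddCommGroup XE12] [NormedSpace ℝ XE12] {HE12 : Type*} [TopologicalSpace HE12]
  {IE12 : ModelWithCorners ℝ XE12 HE12} {E12 : Type*} [TopologicalSpace E12] [ChartedSpace HE12 E12]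
  {XE13 : Type*} [NormedAddCommGroup XE13] [NormedSpace ℝ XE13] {HE13 : Type*} [TopologicalSpace HE13]
  {IE13 : ModelWithCorners ℝ XE13 HE13} {E13 : Type*} [TopologicalSpace E13] [ChartedSpace HE13 E13]
  {XE23 : Type*} [NormedAddCommGroup XE23] [NormedSpace ℝ XE23] {HE23 : Type*} [TopologicalSpace HE23]
  {IE23 : ModelWithCorners ℝ XE23 HE23} {E23 : Type*} [TopologicalSpace E23] [ChartedSpace HE23 E23]
  {XE1 : Type*} [NormedAddCommGroup XE1] [NormedSpace ℝ XE1] {HE1 : Type*} [TopologicalSpace HE1]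
  {IE1 : ModelWithCorners ℝ XE1 HE1} {E1 : Type*} [TopologicalSpace E1] [ChartedSpace HE1 E1]
  {XE2 : Type*} [NormedAddCommGroup XE2] [NormedSpace ℝ XE2] {HE2 : Type*} [TopologicalSpace HE2]
  {IE2 : ModelWithCorners ℝ XE2 HE2} {E2 : Type*} [TopologicalSpace E2] [ChartedSpace HE2 E2]
  {XE3 : Type*} [NormedAddCommGroup XE3] [NormedSpace ℝ XE3] {HE3 : Type*} [TopologicalSpace HE3]
  {IE3 : ModelWithCorners ℝ XE3 HE3} {E3 : Type*} [TopologicalSpace E3] [ChartedSpace HE3 E3]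
  {XM : Type*} [NormedAddCommGroup XM] [NormedSpace ℝ XM] {HM : Type*} [TopologicalSpace HM]
  {IM : ModelWithCorners ℝ XM HM} {M : Type*} [TopologicalSpace M] [ChartedSpace HM M]
variable
  {XE123' : Type*} [NormedAddCommGroup XE123'] [NormedSpace ℝ XE123'] {HE123' : Type*} [TopologicalSpace HE123']
  {IE123' : ModelWithCorners ℝ XE123' HE123'} {E123' : Type*} [TopologicalSpace E123'] [ChartedSpace HE123' E123']
  {XE12' : Type*} [NormedAddCommGroup XE12'] [NormedSpace ℝ XE12'] {HE12' : Type*} [TopologicalSpace HE12']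
  {IE12' : ModelWithCorners ℝ XE12' HE12'} {E12' : Type*} [TopologicalSpace E12'] [ChartedSpace HE12' E12']
  {XE13' : Type*} [NormedAddCommGroup XE13'] [NormedSpace ℝ XE13'] {HE13' : Type*} [TopologicalSpace HE13']
  {IE13' : ModelWithCorners ℝ XE13' HE13'} {E13' : Type*} [TopologicalSpace E13'] [ChartedSpace HE13' E13']
  {XE23' : Type*} [NormedAddCommGroup XE23'] [NormedSpace ℝ XE23'] {HE23' : Type*} [TopologicalSpace HE23']
  {IE23' : ModelWithCorners ℝ XE23' HE23'} {E23' : Type*} [TopologicalSpace E23'] [ChartedSpace HE23' E23']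
  {XE1' : Type*} [NormedAddCommGroup XE1'] [NormedSpace ℝ XE1'] {HE1' : Type*} [TopologicalSpace HE1']
  {IE1' : ModelWithCorners ℝ XE1' HE1'} {E1' : Type*} [TopologicalSpace E1'] [ChartedSpace HE1' E1']
  {XE2' : Type*} [NormedAddCommGroup XE2'] [NormedSpace ℝ XE2'] {HE2' : Type*} [TopologicalSpace HE2']
  {IE2' : ModelWithCorners ℝ XE2' HE2'} {E2' : Type*} [TopologicalSpace E2'] [ChartedSpace HE2' E2']
  {XE3' : Type*} [NormedAddCommGroup XE3'] [NormedSpace ℝ XE3'] {HE3' : Type*} [TopologicalSpace HE3']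
  {IE3' : ModelWithCorners ℝ XE3' HE3'} {E3' : Type*} [TopologicalSpace E3'] [ChartedSpace HE3' E3']
  {XM' : Type*} [NormedAddCommGroup XM'] [NormedSpace ℝ XM'] {HM' : Type*} [TopologicalSpace HM']
  {IM' : ModelWithCorners ℝ XM' HM'} {M' : Type*} [TopologicalSpace M'] [ChartedSpace HM' M']

/-- The Up face. -/
def up (C : VBCube IE123 E123 IE12 E12 IE13 E13 IE23 E23
    IE1 E1 IE2 E2 IE3 E3 IM M) :
    VBSquare IE123 E123 IE23 E23 IE13 E13 IE3 E3 where
  vDA := C.v123_23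
  vDB := C.v123_13
  vA := C.v23_3
  vB := C.v13_3

/-- The Down face. -/
def down (C : VBCube IE123 E123 IE12 E12 IE13 E13 IE23 E23
    IE1 E1 IE2 E2 IE3 E3 IM M) :
    VBSquare IE12 E12 IE2 E2 IE1 E1 IM M where
  vDA := C.v12_2
  vDB := C.v12_1
  vA := C.v2
  vB := C.v1

/-- The Back face. -/
def back (C : VBCube IE123 E123 IE12 E12 IE13 E13 IE23 E23
    IE1 E1 IE2 E2 IE3 E3 IM M) :
    VBSquare IE123 E123 IE12 E12 IE13 E13 IE1 E1 where
  vDA := C.v123_12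
  vDB := C.v123_13
  vA := C.v12_1
  vB := C.v13_1

/-- The Front face. -/
def front (C : VBCube IE123 E123 IE12 E12 IE13 E13 IE23 E23
    IE1 E1 IE2 E2 IE3 E3 IM M) :
    VBSquare IE23 E23 IE2 E2 IE3 E3 IM M where
  vDA := C.v23_2
  vDB := C.v23_3
  vA := C.v2
  vB := C.v3

/-- The Left face. -/
def left (C : VBCube IE123 E123 IE12 E12 IE13 E13 IE23 E23
    IE1 E1 IE2 E2 IE3 E3 IM M) :
    VBSquare IE123 E123 IE12 E12 IE23 E23 IE2 E2 where
  vDA := C.v123_12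
  vDB := C.v123_23
  vA := C.v12_2
  vB := C.v23_2

/-- The Right face. -/
def right (C : VBCube IE123 E123 IE12 E12 IE13 E13 IE23 E23
    IE1 E1 IE2 E2 IE3 E3 IM M) :
    VBSquare IE13 E13 IE1 E1 IE3 E3 IM M where
  vDA := C.v13_1
  vDB := C.v13_3
  vA := C.v1
  vB := C.v3

/-- The flip of a cube which exchanges the first and the third direction: the corners `E12` and
`E23`, and the corners `E1` and `E3`, change places. -/
def flip (C : VBCube IE123 E123 IE12 E12 IE13 E13 IE23 E23
    IE1 E1 IE2 E2 IE3 E3 IM M) :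
    VBCube IE123 E123 IE23 E23 IE13 E13 IE12 E12
      IE3 E3 IE2 E2 IE1 E1 IM M where
  v123_12 := C.v123_23
  v123_13 := C.v123_13
  v123_23 := C.v123_12
  v12_1 := C.v23_3
  v12_2 := C.v23_2
  v13_1 := C.v13_3
  v13_3 := C.v13_1
  v23_2 := C.v12_2
  v23_3 := C.v12_1
  v1 := C.v3
  v2 := C.v2
  v3 := C.v1

/-- All six faces of the cube are double vector bundles. (That the operations of each structure on
`E123` are morphisms of double vector bundles is contained in the interchange laws of the three
faces with total space `E123`.) -/
structure FacesAreDoubleVectorBundles (C : VBCube IE123 E123 IE12 E12 IE13 E13 IE23 E23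
    IE1 E1 IE2 E2 IE3 E3 IM M) :
    Prop where
  up : C.up.IsDoubleVectorBundle
  down : C.down.IsDoubleVectorBundle
  back : C.back.IsDoubleVectorBundle
  front : C.front.IsDoubleVectorBundle
  left : C.left.IsDoubleVectorBundle
  right : C.right.IsDoubleVectorBundle

/-- Morphisms of triple vector bundles: smooth maps of the eight corners which are morphisms of
vector bundles on the twelve edges. -/
structure IsHom (C : VBCube IE123 E123 IE12 E12 IE13 E13 IE23 E23
    IE1 E1 IE2 E2 IE3 E3 IM M)
    (C' : VBCube IE123' E123' IE12' E12' IE13' E13' IE23' E23'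
    IE1' E1' IE2' E2' IE3' E3' IM' M')
    (f123 : E123 → E123') (f12 : E12 → E12') (f13 : E13 → E13') (f23 : E23 → E23')
    (f1 : E1 → E1') (f2 : E2 → E2') (f3 : E3 → E3') (f : M → M') :
    Prop where
  isHom_123_12 : C.v123_12.IsHom C'.v123_12 f123 f12
  isHom_123_13 : C.v123_13.IsHom C'.v123_13 f123 f13
  isHom_123_23 : C.v123_23.IsHom C'.v123_23 f123 f23
  isHom_12_1 : C.v12_1.IsHom C'.v12_1 f12 f1
  isHom_12_2 : C.v12_2.IsHom C'.v12_2 f12 f2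
  isHom_13_1 : C.v13_1.IsHom C'.v13_1 f13 f1
  isHom_13_3 : C.v13_3.IsHom C'.v13_3 f13 f3
  isHom_23_2 : C.v23_2.IsHom C'.v23_2 f23 f2
  isHom_23_3 : C.v23_3.IsHom C'.v23_3 f23 f3
  isHom_1 : C.v1.IsHom C'.v1 f1 f
  isHom_2 : C.v2.IsHom C'.v2 f2 f
  isHom_3 : C.v3.IsHom C'.v3 f3 f

/-- Isomorphisms of triple vector bundles: morphisms with an inverse morphism. -/
def IsIso (C : VBCube IE123 E123 IE12 E12 IE13 E13 IE23 E23
    IE1 E1 IE2 E2 IE3 E3 IM M)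
    (C' : VBCube IE123' E123' IE12' E12' IE13' E13' IE23' E23'
    IE1' E1' IE2' E2' IE3' E3' IM' M')
    (f123 : E123 → E123') (f12 : E12 → E12') (f13 : E13 → E13') (f23 : E23 → E23')
    (f1 : E1 → E1') (f2 : E2 → E2') (f3 : E3 → E3') (f : M → M') :
    Prop :=
  IsHom C C' f123 f12 f13 f23 f1 f2 f3 f ∧
  ∃ g123 g12 g13 g23 g1 g2 g3 g, IsHom C' C g123 g12 g13 g23 g1 g2 g3 g ∧
    (Function.LeftInverse g123 f123 ∧ Function.RightInverse g123 f123) ∧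
    (Function.LeftInverse g12 f12 ∧ Function.RightInverse g12 f12) ∧
    (Function.LeftInverse g13 f13 ∧ Function.RightInverse g13 f13) ∧
    (Function.LeftInverse g23 f23 ∧ Function.RightInverse g23 f23) ∧
    (Function.LeftInverse g1 f1 ∧ Function.RightInverse g1 f1) ∧
    (Function.LeftInverse g2 f2 ∧ Function.RightInverse g2 f2) ∧
    (Function.LeftInverse g3 f3 ∧ Function.RightInverse g3 f3) ∧
    (Function.LeftInverse g f ∧ Function.RightInverse g f)

end

end VBCube

/-! ## The double tangent bundle of a vector bundle -/

section DoubleTangent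

/-- The canonical involution `J_N : T²N → T²N` of a manifold `N`. In the coordinates
`(x, a; b, c)` of `T²N` which a chart of `N` induces it is `(x, a; b, c) ↦ (x, b; a, c)`.

In Mathlib a tangent vector at a point is given by its components in the preferred chart at this
point, and the preferred chart of `TN` at a vector `⟨x, a⟩` is the one induced by the preferred
chart of `N` at `x`. Thus `⟨⟨x, a⟩, (b, c)⟩` is the element of `T²N` with the coordinates
`(x, a; b, c)` for the preferred chart at `x`. The map does not depend on the chart. -/
def canonicalInvolution {X : Type*} [NormedAddCommGroup X] [NormedSpace ℝ X] {H : Type*}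
    [TopologicalSpace H] (I : ModelWithCorners ℝ X H) (N : Type*) [TopologicalSpace N]
    [ChartedSpace H N] [IsManifold I 1 N]
    (v : TangentBundle I.tangent (TangentBundle I N)) :
    TangentBundle I.tangent (TangentBundle I N) :=
  let a : X := v.1.2
  let bc : X × X := v.2
  ⟨⟨v.1.1, (bc.1 : X)⟩, ((a, bc.2) : X × X)⟩

/-- `ξ̄ = d/dt (t ξ) |_{t = 0} ∈ T²N` for `ξ ∈ TN`, with the scalar multiplication of the tangent
bundle `TN → N`. -/
def coreLift {X : Type*} [NormedAddCommGroup X] [NormedSpace ℝ X] {H : Type*}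
    [TopologicalSpace H] (I : ModelWithCorners ℝ X H) (N : Type*) [TopologicalSpace N]
    [ChartedSpace H N] [IsManifold I 1 N] (ξ : TangentBundle I N) :
    TangentBundle I.tangent (TangentBundle I N) :=
  tangentMap 𝓘(ℝ, ℝ) I.tangent (fun t : ℝ ↦ (VBStr.tangentBundle I N).smul t ξ) ⟨0, (1 : ℝ)⟩

/-- The cube `T²A` of a vector bundle `q : A → M` with fibres `V x`, `A = TotalSpace F V`. Its corners
are `E123 = T²A`, `E12 = TA`, `E13 = T²M`, `E23 = TA`, `E1 = TM`, `E2 = A`, `E3 = TM`; the projections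
are
`T²A → TA`, `p_{TA}`; `T²A → T²M`, `T²(q)`; `T²A → TA`, `T(p_A)`;
`E12 → E1`, `T(q)`; `E12 → E2`, `p_A`; `E13 → E1`, `p_{TM}`; `E13 → E3`, `T(p)`;
`E23 → E2`, `p_A`; `E23 → E3`, `T(q)`; and `p`, `q`, `p` over `M`. -/
def doubleTangentCube {X : Type*} [NormedAddCommGroup X] [NormedSpace ℝ X] {H : Type*}
    [TopologicalSpace H] (I : ModelWithCorners ℝ X H) {M : Type*} [TopologicalSpace M]
    [ChartedSpace H M] [IsManifold I ∞ M] (F : Type*) [NormedAddCommGroup F] [NormedSpace ℝ F]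
    (V : M → Type*) [TopologicalSpace (TotalSpace F V)] [∀ x, AddCommGroup (V x)]
    [∀ x, Module ℝ (V x)] [∀ x, TopologicalSpace (V x)] [FiberBundle F V] [VectorBundle ℝ F V]
    [ContMDiffVectorBundle ∞ F V I] :
    VBCube
      (I.prod 𝓘(ℝ, F)).tangent.tangent
      (TangentBundle (I.prod 𝓘(ℝ, F)).tangent (TangentBundle (I.prod 𝓘(ℝ, F)) (TotalSpace F V)))
      (I.prod 𝓘(ℝ, F)).tangent (TangentBundle (I.prod 𝓘(ℝ, F)) (TotalSpace F V))
      I.tangent.tangent (TangentBundle I.tangent (TangentBundle I M))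
      (I.prod 𝓘(ℝ, F)).tangent (TangentBundle (I.prod 𝓘(ℝ, F)) (TotalSpace F V))
      I.tangent (TangentBundle I M)
      (I.prod 𝓘(ℝ, F)) (TotalSpace F V)
      I.tangent (TangentBundle I M)
      I M where
  v123_12 := VBStr.tangentBundle (I.prod 𝓘(ℝ, F)).tangent
    (TangentBundle (I.prod 𝓘(ℝ, F)) (TotalSpace F V))
  v123_13 := (VBStr.ofBundle I F V).tangent.tangent
  v123_23 := (VBStr.tangentBundle (I.prod 𝓘(ℝ, F)) (TotalSpace F V)).tangent
  v12_1 := (VBStr.ofBundle I F V).tangent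
  v12_2 := VBStr.tangentBundle (I.prod 𝓘(ℝ, F)) (TotalSpace F V)
  v13_1 := VBStr.tangentBundle I.tangent (TangentBundle I M)
  v13_3 := (VBStr.tangentBundle I M).tangent
  v23_2 := VBStr.tangentBundle (I.prod 𝓘(ℝ, F)) (TotalSpace F V)
  v23_3 := (VBStr.ofBundle I F V).tangent
  v1 := VBStr.tangentBundle I M
  v2 := VBStr.ofBundle I F V
  v3 := VBStr.tangentBundle I M

end DoubleTangent

end

/-! The proof rests on local trivializations. If `φ` is the fibre coordinate of a local
trivialization of `q : D → B`, a tangent vector of `D` is determined by its images under `T(q)` and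
`T(φ)`, and these can be prescribed (`IsTrivialization.mderiv_ext`,
`IsTrivialization.exists_mderiv`). The operations of `T(q) : TD → TB` are described by what `T(q)`
and `T(φ)` do to them; for the addition, which is a derivative within the fibre product `D ×_B D`,
this uses a retraction of a neighbourhood onto the fibre product
(`IsTrivialization.exists_retraction`). Hence `(T(q), T(φ))` is a local trivialization of the
prolongation, and the prolongation is a vector bundle (`IsVectorBundle.tangent`).

For every vector bundle `D → B` the structures `p_D` and `T(q)` on `TD` form a double vector
bundle: the interchange laws say that derivatives are linear
(`IsVectorBundle.isDoubleVectorBundle_prolongationSquare`). The Down, Front, Back, Left and Right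
faces of the cube are squares of this kind: Down and Front for the bundle `A → M`, Back for
`TA → TM`, Left for `TA → A` and Right for `TM → M`. The Up face is carried to the Back face by
`J_A`, so it is a double vector bundle too (`VBSquare.IsDoubleVectorBundle.of_isHom`).

For the involution, let `L` and `Q` be the first and second derivatives of `f : N → G` in a chart.
Then `T²(f)` is `(x, a; b, c) ↦ (f x, L a; L b, Q b a + L c)`, and the symmetry of `Q` gives
`T²(f) ∘ J = J ∘ T²(f)`. Taking for `f` a chart shows that `J` is smooth; general smooth maps
reduce to vector-valued ones by charts of the target (`canonicalInvolution_tangentMap_tangentMap`).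
Naturality for `q`, its operations and its fibre coordinates makes `J_A` a morphism along `T²(q)`
(`IsVectorBundle.isHom_tangent_tangent`). In coordinates `T(p_N)` is `(x, a; b, c) ↦ (x, b)`, so
`J_N` exchanges the structures `p_{TN}` and `T(p_N)` (`isHom_canonicalInvolution`). The core of the
Left face consists of the vectors `(x, 0; 0, c)`, which are the `d/dt (t ξ)` with `ξ = (x, c)` and
are fixed by `J_A`. -/

noncomputable section

/-! ### Derivatives as maps of the model spaces -/

section Calculus

variable
  {X : Type*} [NormedAddCommGroup X] [NormedSpace ℝ X] {H : Type*} [TopologicalSpace H]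
  {I : ModelWithCorners ℝ X H} {N : Type*} [TopologicalSpace N] [ChartedSpace H N]
  {X' : Type*} [NormedAddCommGroup X'] [NormedSpace ℝ X'] {H' : Type*} [TopologicalSpace H']
  {I' : ModelWithCorners ℝ X' H'} {N' : Type*} [TopologicalSpace N'] [ChartedSpace H' N']
  {X'' : Type*} [NormedAddCommGroup X''] [NormedSpace ℝ X''] {H'' : Type*} [TopologicalSpace H'']
  {I'' : ModelWithCorners ℝ X'' H''} {N'' : Type*} [TopologicalSpace N''] [ChartedSpace H'' N'']
  {G : Type*} [NormedAddCommGroup G] [NormedSpace ℝ G]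
  {G' : Type*} [NormedAddCommGroup G'] [NormedSpace ℝ G']

/-- The components of a tangent vector in the preferred chart at its base point, as an element of
the model space. -/
def TangentBundle.vec (v : TangentBundle I N) : X := v.2

theorem TangentBundle.ext_vec {v w : TangentBundle I N} (h : v.proj = w.proj)
    (h' : v.vec = w.vec) : v = w := by
  obtain ⟨x, a⟩ := v
  obtain ⟨y, b⟩ := w
  obtain rfl : x = y := h
  exact congrArg (TotalSpace.mk x) h'

variable (I I') in
/-- The derivative `mfderiv` read as a map of the model spaces, so that its type does not depend on
the point. -/
def mderiv (f : N → N') (x : N) : X →L[ℝ] X' := mfderiv I I' f x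

@[simp] theorem tangentMap_fst (f : N → N') (v : TangentBundle I N) :
    (tangentMap I I' f v).proj = f v.proj := rfl

theorem mderiv_comp {g : N' → N''} {f : N → N'} {x : N} (hg : MDifferentiableAt I' I'' g (f x))
    (hf : MDifferentiableAt I I' f x) (v : X) :
    mderiv I I'' (fun y ↦ g (f y)) x v = mderiv I' I'' g (f x) (mderiv I I' f x v) := by
  have := mfderiv_comp x hg hf
  exact congrArg (fun L : X →L[ℝ] X'' ↦ L v) this

theorem mderiv_congr {f g : N → N'} {x : N} (h : f =ᶠ[𝓝 x] g) :
    mderiv I I' f x = mderiv I I' g x := h.mfderiv_eq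

@[simp] theorem mderiv_id (x : N) : mderiv I I (fun y : N ↦ y) x = ContinuousLinearMap.id ℝ X :=
  mfderiv_id

theorem mderiv_clm {f : N → G} {x : N} (hf : MDifferentiableAt I 𝓘(ℝ, G) f x) (L : G →L[ℝ] G')
    (v : X) : mderiv I 𝓘(ℝ, G') (fun y ↦ L (f y)) x v = L (mderiv I 𝓘(ℝ, G) f x v) := by
  rw [mderiv_comp (g := L) L.differentiableAt.mdifferentiableAt hf]
  congr 1
  exact (mfderiv_eq_fderiv (f := L)).trans L.fderiv

theorem mderiv_add {f g : N → G} {x : N} (hf : MDifferentiableAt I 𝓘(ℝ, G) f x)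
    (hg : MDifferentiableAt I 𝓘(ℝ, G) g x) (v : X) :
    mderiv I 𝓘(ℝ, G) (fun y ↦ f y + g y) x v
      = mderiv I 𝓘(ℝ, G) f x v + mderiv I 𝓘(ℝ, G) g x v := by
  have := mfderiv_add hf hg
  exact congrArg (fun L : X →L[ℝ] G ↦ L v) this

@[simp] theorem mderiv_const (c : N') (x : N) : mderiv I I' (fun _ ↦ c) x = 0 := mfderiv_const

theorem mderiv_fst (p : N × N') (v : X × X') :
    mderiv (I.prod I') I (fun p : N × N' ↦ p.1) p v = v.1 := by
  have := mfderiv_fst (I := I) (I' := I') (x := p)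
  exact congrArg (fun L : X × X' →L[ℝ] X ↦ L v) this

theorem mderiv_snd (p : N × N') (v : X × X') :
    mderiv (I.prod I') I' (fun p : N × N' ↦ p.2) p v = v.2 := by
  have := mfderiv_snd (I := I) (I' := I') (x := p)
  exact congrArg (fun L : X × X' →L[ℝ] X' ↦ L v) this

theorem mderiv_prodMk {f : N → N'} {g : N → N''} {x : N} (hf : MDifferentiableAt I I' f x)
    (hg : MDifferentiableAt I I'' g x) (v : X) :
    mderiv I (I'.prod I'') (fun y ↦ (f y, g y)) x v = (mderiv I I' f x v, mderiv I I'' g x v) := by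
  have := mfderiv_prodMk hf hg
  exact congrArg (fun L : X →L[ℝ] X' × X'' ↦ L v) this

theorem tangentMap_comp_apply {g : N' → N''} {f : N → N'} {v : TangentBundle I N}
    (hg : MDifferentiableAt I' I'' g (f v.proj)) (hf : MDifferentiableAt I I' f v.proj) :
    tangentMap I I'' (fun y ↦ g (f y)) v = tangentMap I' I'' g (tangentMap I I' f v) :=
  tangentMap_comp_at v hg hf

variable (I) in
/-- For a map `f` to a vector space `G`, the tangent map of `f` under the identification
`TG = G × G`. -/
def tangentPair (f : N → G) (v : TangentBundle I N) : G × G :=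
  (f v.proj, mderiv I 𝓘(ℝ, G) f v.proj v.vec)

theorem tangentPair_comp {g : N' → G} {f : N → N'} {v : TangentBundle I N}
    (hg : MDifferentiableAt I' 𝓘(ℝ, G) g (f v.proj)) (hf : MDifferentiableAt I I' f v.proj) :
    tangentPair I (fun y ↦ g (f y)) v = tangentPair I' g (tangentMap I I' f v) :=
  Prod.ext rfl (mderiv_comp hg hf _)

theorem tangentPair_congr {f g : N → G} {v : TangentBundle I N} (h : f =ᶠ[𝓝 v.proj] g) :
    tangentPair I f v = tangentPair I g v := by
  simp only [tangentPair, mderiv_congr h, h.self_of_nhds]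

theorem contMDiffOn_tangentMap [IsManifold I ∞ N] [IsManifold I' ∞ N'] {f : N → N'} {s : Set N}
    (hf : ContMDiffOn I I' ∞ f s) (hs : IsOpen s) :
    ContMDiffOn I.tangent I'.tangent ∞ (tangentMap I I' f) (TotalSpace.proj ⁻¹' s) := by
  refine (hf.contMDiffOn_tangentMapWithin (m := ∞) le_rfl hs.uniqueMDiffOn).congr fun v hv ↦ ?_
  exact (tangentMapWithin_eq_tangentMap (hs.uniqueMDiffWithinAt hv)
    (((hf _ hv).contMDiffAt (hs.mem_nhds hv)).mdifferentiableAt (by simp))).symm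

theorem contMDiff_tangentMap [IsManifold I ∞ N] [IsManifold I' ∞ N'] {f : N → N'}
    (hf : ContMDiff I I' ∞ f) : ContMDiff I.tangent I'.tangent ∞ (tangentMap I I' f) :=
  hf.contMDiff_tangentMap le_rfl

theorem contMDiffOn_tangentPair [IsManifold I ∞ N] {f : N → G} {s : Set N}
    (hf : ContMDiffOn I 𝓘(ℝ, G) ∞ f s) (hs : IsOpen s) :
    ContMDiffOn I.tangent 𝓘(ℝ, G × G) ∞ (tangentPair I f) (TotalSpace.proj ⁻¹' s) := by
  have h1 : ContMDiffOn I.tangent 𝓘(ℝ, G) ∞ (fun v : TangentBundle I N ↦ f v.proj)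
      (TotalSpace.proj ⁻¹' s) :=
    hf.comp (contMDiff_proj (TangentSpace I)).contMDiffOn fun v hv ↦ hv
  have h2 := (contMDiff_snd_tangentBundle_modelSpace (n := ∞) G 𝓘(ℝ, G)).comp_contMDiffOn
    (contMDiffOn_tangentMap hf hs)
  exact h1.prodMk_space h2

theorem contMDiff_mk_modelSpace :
    ContMDiff 𝓘(ℝ, G × G) 𝓘(ℝ, G).tangent ∞
      (fun p : G × G ↦ (⟨p.1, p.2⟩ : TangentBundle 𝓘(ℝ, G) G)) := by
  intro p
  rw [contMDiffAt_totalSpace]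
  refine ⟨contDiff_fst.contMDiff p, ?_⟩
  refine (contDiff_snd.contMDiff p).congr_of_eventuallyEq (Filter.Eventually.of_forall fun y ↦ ?_)
  simp

end Calculus

/-! ### Local trivializations and their derivatives -/

namespace VBStr

section Trivializations

variable
  {XD : Type*} [NormedAddCommGroup XD] [NormedSpace ℝ XD] {HD : Type*} [TopologicalSpace HD]
  {ID : ModelWithCorners ℝ XD HD} {D : Type*} [TopologicalSpace D] [ChartedSpace HD D]
  {XB : Type*} [NormedAddCommGroup XB] [NormedSpace ℝ XB] {HB : Type*} [TopologicalSpace HB]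
  {IB : ModelWithCorners ℝ XB HB} {B : Type*} [TopologicalSpace B] [ChartedSpace HB B]
  {G : Type*} [NormedAddCommGroup G] [NormedSpace ℝ G]
  {G' : Type*} [NormedAddCommGroup G'] [NormedSpace ℝ G']

/-- The part of the laws of a vector bundle that does not refer to a local trivialization. -/
structure IsFibred (V : VBStr ID D IB B) : Prop where
  contMDiff_proj : ContMDiff ID IB ∞ V.proj
  proj_zero : ∀ b, V.proj (V.zero b) = b
  proj_add : ∀ d d', V.proj d = V.proj d' → V.proj (V.add d d') = V.proj d
  proj_smul : ∀ (t : ℝ) d, V.proj (V.smul t d) = V.proj d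

/-- `d ↦ (proj d, φ d)` is a smooth local trivialization over the open set `U`, with inverse `ψ`.
The model fibre `G` may be any normed space. -/
structure IsTrivialization (V : VBStr ID D IB B) (U : Set B) (φ : D → G) (ψ : B × G → D) :
    Prop extends V.IsFibred where
  isOpen : IsOpen U
  contMDiffOn_fibre : ContMDiffOn ID 𝓘(ℝ, G) ∞ φ (V.proj ⁻¹' U)
  contMDiffOn_symm : ContMDiffOn (IB.prod 𝓘(ℝ, G)) ID ∞ ψ (U ×ˢ univ)
  proj_symm : ∀ b ∈ U, ∀ f, V.proj (ψ (b, f)) = b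
  fibre_symm : ∀ b ∈ U, ∀ f, φ (ψ (b, f)) = f
  symm_apply : ∀ d, V.proj d ∈ U → ψ (V.proj d, φ d) = d
  fibre_zero : ∀ b ∈ U, φ (V.zero b) = 0
  fibre_add : ∀ d d', V.proj d ∈ U → V.proj d = V.proj d' → φ (V.add d d') = φ d + φ d'
  fibre_smul : ∀ (t : ℝ) d, V.proj d ∈ U → φ (V.smul t d) = t • φ d

theorem IsVectorBundle.isFibred {V : VBStr ID D IB B} (hV : V.IsVectorBundle) : V.IsFibred :=
  ⟨hV.contMDiff_proj, hV.proj_zero, hV.proj_add, hV.proj_smul⟩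

theorem IsVectorBundle.exists_isTrivialization {V : VBStr ID D IB B} (hV : V.IsVectorBundle)
    (b : B) : ∃ (U : Set B) (n : ℕ) (φ : D → (Fin n → ℝ)) (ψ : B × (Fin n → ℝ) → D),
      b ∈ U ∧ V.IsTrivialization U φ ψ := by
  obtain ⟨U, n, φ, ψ, hU, hb, h1, h2, h3, h4, h5, h6, h7⟩ := hV.locally_trivial b
  exact ⟨U, n, φ, ψ, hb, ⟨hV.isFibred, hU, h1, h2, fun b hb f ↦ (h3 b hb f).1,
    fun b hb f ↦ (h3 b hb f).2, h4, h5, h6, h7⟩⟩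

namespace IsTrivialization

variable {V : VBStr ID D IB B} {U : Set B} {φ : D → G} {ψ : B × G → D}

/-- The model fibre of a local trivialization may be replaced by an isomorphic one. -/
theorem congr_fibre (h : V.IsTrivialization U φ ψ) (e : G ≃L[ℝ] G') :
    V.IsTrivialization U (fun d ↦ e (φ d)) (fun p : B × G' ↦ ψ (p.1, e.symm p.2)) where
  toIsFibred := h.toIsFibred
  isOpen := h.isOpen
  contMDiffOn_fibre := e.contDiff.contMDiff.comp_contMDiffOn h.contMDiffOn_fibre
  contMDiffOn_symm := by
    refine h.contMDiffOn_symm.comp (t := U ×ˢ univ)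
      (contMDiff_fst.prodMk (e.symm.contDiff.contMDiff.comp contMDiff_snd)).contMDiffOn ?_
    rintro ⟨b, f⟩ ⟨hb, -⟩
    exact ⟨hb, mem_univ _⟩
  proj_symm b hb f := h.proj_symm b hb _
  fibre_symm b hb f := by simp [h.fibre_symm b hb]
  symm_apply d hd := by simp [h.symm_apply d hd]
  fibre_zero b hb := by simp [h.fibre_zero b hb]
  fibre_add d d' hd hd' := by simp [h.fibre_add d d' hd hd']
  fibre_smul t d hd := by simp [h.fibre_smul t d hd]

theorem isOpen_preimage (h : V.IsTrivialization U φ ψ) : IsOpen (V.proj ⁻¹' U) :=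
  h.isOpen.preimage h.contMDiff_proj.continuous

theorem preimage_mem_nhds (h : V.IsTrivialization U φ ψ) {d : D} (hd : V.proj d ∈ U) :
    V.proj ⁻¹' U ∈ 𝓝 d := h.isOpen_preimage.mem_nhds hd

theorem contMDiffAt_fibre (h : V.IsTrivialization U φ ψ) {d : D} (hd : V.proj d ∈ U) :
    ContMDiffAt ID 𝓘(ℝ, G) ∞ φ d :=
  (h.contMDiffOn_fibre d hd).contMDiffAt (h.preimage_mem_nhds hd)

theorem contMDiffAt_symm (h : V.IsTrivialization U φ ψ) {p : B × G} (hp : p.1 ∈ U) :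
    ContMDiffAt (IB.prod 𝓘(ℝ, G)) ID ∞ ψ p :=
  (h.contMDiffOn_symm p ⟨hp, mem_univ _⟩).contMDiffAt
    ((h.isOpen.prod isOpen_univ).mem_nhds ⟨hp, mem_univ _⟩)

theorem mdifferentiableAt_proj (h : V.IsTrivialization U φ ψ) (d : D) :
    MDifferentiableAt ID IB V.proj d := h.contMDiff_proj.mdifferentiableAt (by simp)

theorem mdifferentiableAt_fibre (h : V.IsTrivialization U φ ψ) {d : D} (hd : V.proj d ∈ U) :
    MDifferentiableAt ID 𝓘(ℝ, G) φ d := (h.contMDiffAt_fibre hd).mdifferentiableAt (by simp)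

theorem mdifferentiableAt_symm (h : V.IsTrivialization U φ ψ) {p : B × G} (hp : p.1 ∈ U) :
    MDifferentiableAt (IB.prod 𝓘(ℝ, G)) ID ψ p :=
  (h.contMDiffAt_symm hp).mdifferentiableAt (by simp)

/-- An element of the total space is determined by its base point and its fibre coordinate. -/
theorem ext (h : V.IsTrivialization U φ ψ) {d d' : D} (hd : V.proj d ∈ U)
    (h1 : V.proj d = V.proj d') (h2 : φ d = φ d') : d = d' := by
  rw [← h.symm_apply d hd, ← h.symm_apply d' (h1 ▸ hd), h1, h2]

theorem contMDiffAt_zero (h : V.IsTrivialization U φ ψ) {b : B} (hb : b ∈ U) :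
    ContMDiffAt IB ID ∞ V.zero b := by
  have h1 : ContMDiffAt IB ID ∞ (fun c ↦ ψ (c, 0)) b :=
    ContMDiffAt.comp b (h.contMDiffAt_symm (p := (b, 0)) hb)
      (contMDiffAt_id.prodMk contMDiffAt_const)
  refine h1.congr_of_eventuallyEq ?_
  filter_upwards [h.isOpen.mem_nhds hb] with c hc
  have := h.symm_apply (V.zero c) (by rwa [h.proj_zero])
  rw [h.proj_zero, h.fibre_zero c hc] at this
  exact this.symm

theorem contMDiffAt_smul (h : V.IsTrivialization U φ ψ) (t : ℝ) {d : D} (hd : V.proj d ∈ U) :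
    ContMDiffAt ID ID ∞ (V.smul t) d := by
  have h1 : ContMDiffAt ID ID ∞ (fun c ↦ ψ (V.proj c, t • φ c)) d :=
    ContMDiffAt.comp d (h.contMDiffAt_symm (p := (V.proj d, t • φ d)) hd)
      (h.contMDiff_proj.contMDiffAt.prodMk
        ((contDiff_const_smul t).contMDiff.contMDiffAt.comp d (h.contMDiffAt_fibre hd)))
  refine h1.congr_of_eventuallyEq ?_
  filter_upwards [h.preimage_mem_nhds hd] with c hc
  have := h.symm_apply (V.smul t c) (by rwa [h.proj_smul])
  rw [h.proj_smul, h.fibre_smul t c hc] at this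
  exact this.symm

/-! A tangent vector of the total space is determined by its images under the derivatives of the
projection and of the fibre coordinate, and these images can be prescribed. -/

theorem mderiv_symm (h : V.IsTrivialization U φ ψ) {d : D} (hd : V.proj d ∈ U) (v : XD) :
    mderiv (IB.prod 𝓘(ℝ, G)) ID ψ (V.proj d, φ d)
      (mderiv ID IB V.proj d v, mderiv ID 𝓘(ℝ, G) φ d v) = v := by
  rw [← mderiv_prodMk (h.mdifferentiableAt_proj d) (h.mdifferentiableAt_fibre hd),
    ← mderiv_comp (f := fun y ↦ (V.proj y, φ y))
      (h.mdifferentiableAt_symm (p := (V.proj d, φ d)) hd)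
      ((h.mdifferentiableAt_proj d).prodMk (h.mdifferentiableAt_fibre hd))]
  rw [mderiv_congr (g := fun y ↦ y), mderiv_id]
  · rfl
  · filter_upwards [h.preimage_mem_nhds hd] with c hc using h.symm_apply c hc

theorem mderiv_ext (h : V.IsTrivialization U φ ψ) {d : D} (hd : V.proj d ∈ U) {v w : XD}
    (h1 : mderiv ID IB V.proj d v = mderiv ID IB V.proj d w)
    (h2 : mderiv ID 𝓘(ℝ, G) φ d v = mderiv ID 𝓘(ℝ, G) φ d w) : v = w := by
  rw [← h.mderiv_symm hd v, ← h.mderiv_symm hd w, h1, h2]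

theorem mderiv_proj_symm (h : V.IsTrivialization U φ ψ) {p : B × G} (hp : p.1 ∈ U) (v : XB × G) :
    mderiv ID IB V.proj (ψ p) (mderiv (IB.prod 𝓘(ℝ, G)) ID ψ p v) = v.1 := by
  rw [← mderiv_comp (h.mdifferentiableAt_proj _) (h.mdifferentiableAt_symm hp),
    mderiv_congr (g := fun p : B × G ↦ p.1), mderiv_fst]
  filter_upwards [(h.isOpen.preimage continuous_fst).mem_nhds hp] with c hc using h.proj_symm _ hc _

theorem mderiv_fibre_symm (h : V.IsTrivialization U φ ψ) {p : B × G} (hp : p.1 ∈ U) (v : XB × G) :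
    mderiv ID 𝓘(ℝ, G) φ (ψ p) (mderiv (IB.prod 𝓘(ℝ, G)) ID ψ p v) = v.2 := by
  rw [← mderiv_comp (h.mdifferentiableAt_fibre (by rwa [h.proj_symm _ hp]))
    (h.mdifferentiableAt_symm hp), mderiv_congr (g := fun p : B × G ↦ p.2), mderiv_snd]
  filter_upwards [(h.isOpen.preimage continuous_fst).mem_nhds hp] with c hc
    using h.fibre_symm _ hc _

theorem exists_mderiv (h : V.IsTrivialization U φ ψ) {d : D} (hd : V.proj d ∈ U) (β : XB) (g : G) :
    ∃ v : XD, mderiv ID IB V.proj d v = β ∧ mderiv ID 𝓘(ℝ, G) φ d v = g := by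
  refine ⟨mderiv (IB.prod 𝓘(ℝ, G)) ID ψ (V.proj d, φ d) (β, g), ?_, ?_⟩
  · have := h.mderiv_proj_symm (p := (V.proj d, φ d)) hd (β, g)
    rwa [h.symm_apply d hd] at this
  · have := h.mderiv_fibre_symm (p := (V.proj d, φ d)) hd (β, g)
    rwa [h.symm_apply d hd] at this

/-! The derivatives of the zero section and of the scalar multiplication. -/

theorem mderiv_proj_zero (h : V.IsTrivialization U φ ψ) {b : B} (hb : b ∈ U) (β : XB) :
    mderiv ID IB V.proj (V.zero b) (mderiv IB ID V.zero b β) = β := by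
  rw [← mderiv_comp (h.mdifferentiableAt_proj _)
    ((h.contMDiffAt_zero hb).mdifferentiableAt (by simp))]
  simp [h.proj_zero]

theorem mderiv_fibre_zero (h : V.IsTrivialization U φ ψ) {b : B} (hb : b ∈ U) (β : XB) :
    mderiv ID 𝓘(ℝ, G) φ (V.zero b) (mderiv IB ID V.zero b β) = 0 := by
  rw [← mderiv_comp (h.mdifferentiableAt_fibre (by rwa [h.proj_zero]))
    ((h.contMDiffAt_zero hb).mdifferentiableAt (by simp)), mderiv_congr (g := fun _ ↦ 0)]
  · simp
  · filter_upwards [h.isOpen.mem_nhds hb] with c hc using h.fibre_zero c hc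

theorem mderiv_proj_smul (h : V.IsTrivialization U φ ψ) (t : ℝ) {d : D} (hd : V.proj d ∈ U)
    (v : XD) : mderiv ID IB V.proj (V.smul t d) (mderiv ID ID (V.smul t) d v)
      = mderiv ID IB V.proj d v := by
  rw [← mderiv_comp (h.mdifferentiableAt_proj _)
    ((h.contMDiffAt_smul t hd).mdifferentiableAt (by simp))]
  simp [h.proj_smul]

theorem mderiv_fibre_smul (h : V.IsTrivialization U φ ψ) (t : ℝ) {d : D} (hd : V.proj d ∈ U)
    (v : XD) : mderiv ID 𝓘(ℝ, G) φ (V.smul t d) (mderiv ID ID (V.smul t) d v)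
      = t • mderiv ID 𝓘(ℝ, G) φ d v := by
  rw [← mderiv_comp (h.mdifferentiableAt_fibre (by rwa [h.proj_smul]))
    ((h.contMDiffAt_smul t hd).mdifferentiableAt (by simp)), mderiv_congr (g := fun c ↦ t • φ c)]
  · exact mderiv_clm (h.mdifferentiableAt_fibre hd) (t • ContinuousLinearMap.id ℝ G) v
  · filter_upwards [h.preimage_mem_nhds hd] with c hc using h.fibre_smul t c hc

end IsTrivialization

/-- The derivative of the addition `D ×_B D → D` within the fibre product. -/
def addDeriv (V : VBStr ID D IB B) (d d' : D) : XD × XD →L[ℝ] XD :=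
  mfderivWithin (ID.prod ID) ID (fun p : D × D ↦ V.add p.1 p.2)
    {p : D × D | V.proj p.1 = V.proj p.2} (d, d')

namespace IsTrivialization

variable {V : VBStr ID D IB B} {U : Set B} {φ : D → G} {ψ : B × G → D}

/-- The map `(d, d') ↦ (d, ψ (proj d, φ d'))` retracts a neighbourhood of the fibre product in
`D × D` onto the fibre product. Its composition with the addition is smooth near the fibre product,
which gives access to the derivative of the addition. -/
theorem exists_retraction (h : V.IsTrivialization U φ ψ) {d d' : D} (hd : V.proj d ∈ U)
    (hdd : V.proj d = V.proj d') {v w : XD}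
    (hvw : mderiv ID IB V.proj d v = mderiv ID IB V.proj d' w) :
    ∃ a : D × D → D, ContMDiffAt (ID.prod ID) ID ∞ a (d, d') ∧ a (d, d') = V.add d d' ∧
      (∀ᶠ p in 𝓝 (d, d'), V.proj (a p) = V.proj p.1 ∧ φ (a p) = φ p.1 + φ p.2) ∧
      V.addDeriv d d' (v, w) = mderiv (ID.prod ID) ID a (d, d') (v, w) := by
  have hd' : V.proj d' ∈ U := hdd ▸ hd
  set W : Set (D × D) := (V.proj ⁻¹' U) ×ˢ (V.proj ⁻¹' U) with hW
  have hWn : W ∈ 𝓝 (d, d') := prod_mem_nhds (h.preimage_mem_nhds hd) (h.preimage_mem_nhds hd')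
  set S : Set (D × D) := {p : D × D | V.proj p.1 = V.proj p.2} with hS
  set m : D × D → D := fun p ↦ V.add p.1 p.2 with hm
  set σ : D × D → D := fun p ↦ ψ (V.proj p.1, φ p.2) with hσ
  set a : D × D → D := fun p ↦ ψ (V.proj p.1, φ p.1 + φ p.2) with ha
  have c1 : ContMDiffAt (ID.prod ID) IB ∞ (fun p : D × D ↦ V.proj p.1) (d, d') :=
    h.contMDiff_proj.contMDiffAt.comp (d, d') contMDiffAt_fst
  have c2 : ContMDiffAt (ID.prod ID) 𝓘(ℝ, G) ∞ (fun p : D × D ↦ φ p.1) (d, d') :=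
    ContMDiffAt.comp (d, d') (h.contMDiffAt_fibre (d := ((d, d') : D × D).1) hd) contMDiffAt_fst
  have c3 : ContMDiffAt (ID.prod ID) 𝓘(ℝ, G) ∞ (fun p : D × D ↦ φ p.2) (d, d') :=
    ContMDiffAt.comp (d, d') (h.contMDiffAt_fibre (d := ((d, d') : D × D).2) hd') contMDiffAt_snd
  have hσs : ContMDiffAt (ID.prod ID) ID ∞ σ (d, d') :=
    ContMDiffAt.comp (d, d') (h.contMDiffAt_symm (p := (V.proj d, φ d')) hd) (c1.prodMk c3)
  have has : ContMDiffAt (ID.prod ID) ID ∞ a (d, d') :=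
    ContMDiffAt.comp (d, d') (h.contMDiffAt_symm (p := (V.proj d, φ d + φ d')) hd)
      (c1.prodMk (c2.add c3))
  have hσ0 : σ (d, d') = d' := by simp only [hσ, hdd, h.symm_apply d' hd']
  have hma : ∀ p ∈ W ∩ S, m p = a p := by
    rintro ⟨c, c'⟩ ⟨⟨hc, hc'⟩, hcc⟩
    change V.proj c = V.proj c' at hcc
    have := h.symm_apply (V.add c c') (by rw [h.proj_add _ _ hcc]; exact hc)
    rw [h.proj_add _ _ hcc, h.fibre_add _ _ hc hcc] at this
    exact this.symm
  have hmaσ : ∀ p ∈ W, m (p.1, σ p) = a p := by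
    rintro ⟨c, c'⟩ ⟨hc, hc'⟩
    have hp : V.proj (σ (c, c')) = V.proj c := h.proj_symm _ hc _
    have hf : φ (σ (c, c')) = φ c' := h.fibre_symm _ hc _
    have := hma (c, σ (c, c')) ⟨⟨hc, by rw [mem_preimage, hp]; exact hc⟩, hp.symm⟩
    rw [this]
    simp only [ha, hf]
  have hmdiff : MDifferentiableWithinAt (ID.prod ID) ID m S (d, d') := by
    refine (has.mdifferentiableAt (by simp)).mdifferentiableWithinAt.congr_of_eventuallyEq ?_
      (hma _ ⟨⟨hd, hd'⟩, hdd⟩)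
    filter_upwards [mem_nhdsWithin_of_mem_nhds hWn, self_mem_nhdsWithin] with p hp hp'
      using hma p ⟨hp, hp'⟩
  refine ⟨a, has, (hma (d, d') ⟨⟨hd, hd'⟩, hdd⟩).symm, ?_, ?_⟩
  · filter_upwards [hWn] with p hp using ⟨h.proj_symm _ hp.1 _, h.fibre_symm _ hp.1 _⟩
  have hσd : MDifferentiableAt (ID.prod ID) ID σ (d, d') := hσs.mdifferentiableAt (by simp)
  set r : D × D → D × D := fun p ↦ (p.1, σ p) with hr
  have hrd : MDifferentiableAt (ID.prod ID) (ID.prod ID) r (d, d') :=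
    mdifferentiableAt_fst.prodMk hσd
  have hr0 : r (d, d') = (d, d') := Prod.ext rfl hσ0
  have hrS : r ⁻¹' S ∈ 𝓝 (d, d') := by
    filter_upwards [hWn] with p hp
    exact (h.proj_symm _ hp.1 _).symm
  have hchain := mfderivWithin_comp_of_preimage_mem_nhdsWithin_of_eq (s := univ) (x := (d, d'))
    (y := (d, d')) hmdiff hrd.mdifferentiableWithinAt (by simpa using hrS)
    (uniqueMDiffWithinAt_univ _) hr0
  rw [mfderivWithin_univ, mfderivWithin_univ] at hchain
  have hchain' : mderiv (ID.prod ID) ID (fun p ↦ m (r p)) (d, d') (v, w)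
      = V.addDeriv d d' (mderiv (ID.prod ID) (ID.prod ID) r (d, d') (v, w)) :=
    congrArg (fun L : XD × XD →L[ℝ] XD ↦ L (v, w)) hchain
  have hrvw : mderiv (ID.prod ID) (ID.prod ID) r (d, d') (v, w) = (v, w) := by
    rw [hr, mderiv_prodMk mdifferentiableAt_fst hσd, mderiv_fst]
    refine Prod.ext rfl (h.mderiv_ext hd' ?_ ?_)
    · have e1 := mderiv_comp (x := (d, d')) (h.mdifferentiableAt_proj (σ (d, d'))) hσd (v, w)
      rw [mderiv_congr (g := fun p : D × D ↦ V.proj p.1), mderiv_comp (f := fun p : D × D ↦ p.1)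
        (h.mdifferentiableAt_proj _) mdifferentiableAt_fst, mderiv_fst, hσ0] at e1
      · exact e1.symm.trans hvw
      · filter_upwards [hWn] with p hp using h.proj_symm _ hp.1 _
    · have e1 := mderiv_comp (x := (d, d')) (g := φ)
        (h.mdifferentiableAt_fibre (d := σ (d, d')) (by rwa [hσ0])) hσd (v, w)
      rw [mderiv_congr (g := fun p : D × D ↦ φ p.2), mderiv_comp (f := fun p : D × D ↦ p.2)
        (h.mdifferentiableAt_fibre hd') mdifferentiableAt_snd, mderiv_snd, hσ0] at e1
      · exact e1.symm
      · filter_upwards [hWn] with p hp using h.fibre_symm _ hp.1 _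
  rw [hrvw] at hchain'
  rw [← hchain', mderiv_congr]
  filter_upwards [hWn] with p hp using hmaσ p hp

theorem mderiv_proj_addDeriv (h : V.IsTrivialization U φ ψ) {d d' : D} (hd : V.proj d ∈ U)
    (hdd : V.proj d = V.proj d') {v w : XD}
    (hvw : mderiv ID IB V.proj d v = mderiv ID IB V.proj d' w) :
    mderiv ID IB V.proj (V.add d d') (V.addDeriv d d' (v, w)) = mderiv ID IB V.proj d v := by
  obtain ⟨a, ha, ha0, hpa, hav⟩ := h.exists_retraction hd hdd hvw
  rw [hav, ← ha0, ← mderiv_comp (h.mdifferentiableAt_proj _) (ha.mdifferentiableAt (by simp)),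
    mderiv_congr (g := fun p : D × D ↦ V.proj p.1), mderiv_comp (f := fun p : D × D ↦ p.1)
      (h.mdifferentiableAt_proj _) mdifferentiableAt_fst, mderiv_fst]
  filter_upwards [hpa] with p hp using hp.1

theorem mderiv_fibre_addDeriv (h : V.IsTrivialization U φ ψ) {d d' : D} (hd : V.proj d ∈ U)
    (hdd : V.proj d = V.proj d') {v w : XD}
    (hvw : mderiv ID IB V.proj d v = mderiv ID IB V.proj d' w) :
    mderiv ID 𝓘(ℝ, G) φ (V.add d d') (V.addDeriv d d' (v, w))
      = mderiv ID 𝓘(ℝ, G) φ d v + mderiv ID 𝓘(ℝ, G) φ d' w := by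
  obtain ⟨a, ha, ha0, hpa, hav⟩ := h.exists_retraction hd hdd hvw
  have h1 := h.mdifferentiableAt_fibre hd
  have h2 := h.mdifferentiableAt_fibre (d := d') (hdd ▸ hd)
  rw [hav, ← ha0, ← mderiv_comp (h.mdifferentiableAt_fibre (by rwa [ha0, h.proj_add _ _ hdd]))
      (ha.mdifferentiableAt (by simp)), mderiv_congr (g := fun p : D × D ↦ φ p.1 + φ p.2),
    mderiv_add (f := fun p : D × D ↦ φ p.1) (g := fun p : D × D ↦ φ p.2)
      (h1.comp (d, d') mdifferentiableAt_fst) (h2.comp (d, d') mdifferentiableAt_snd),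
    mderiv_comp (f := fun p : D × D ↦ p.1) h1 mdifferentiableAt_fst,
    mderiv_comp (f := fun p : D × D ↦ p.2) h2 mdifferentiableAt_snd, mderiv_fst, mderiv_snd]
  filter_upwards [hpa] with p hp using hp.2

end IsTrivialization

end Trivializations

end VBStr

/-! ### The tangent prolongation of a vector bundle is a vector bundle -/

namespace VBStr

section Prolongation

variable
  {XD : Type*} [NormedAddCommGroup XD] [NormedSpace ℝ XD] {HD : Type*} [TopologicalSpace HD]
  {ID : ModelWithCorners ℝ XD HD} {D : Type*} [TopologicalSpace D] [ChartedSpace HD D]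
  {XB : Type*} [NormedAddCommGroup XB] [NormedSpace ℝ XB] {HB : Type*} [TopologicalSpace HB]
  {IB : ModelWithCorners ℝ XB HB} {B : Type*} [TopologicalSpace B] [ChartedSpace HB B]
  {G : Type*} [NormedAddCommGroup G] [NormedSpace ℝ G]

theorem IsVectorBundle.of_isTrivialization {V : VBStr ID D IB B} (hV : V.IsFibred)
    (h : ∀ b : B, ∃ (U : Set B) (n : ℕ) (φ : D → (Fin n → ℝ)) (ψ : B × (Fin n → ℝ) → D),
      b ∈ U ∧ V.IsTrivialization U φ ψ) : V.IsVectorBundle where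
  contMDiff_proj := hV.contMDiff_proj
  proj_zero := hV.proj_zero
  proj_add := hV.proj_add
  proj_smul := hV.proj_smul
  locally_trivial b := by
    obtain ⟨U, n, φ, ψ, hb, h⟩ := h b
    exact ⟨U, n, φ, ψ, h.isOpen, hb, h.contMDiffOn_fibre, h.contMDiffOn_symm,
      fun b hb f ↦ ⟨h.proj_symm b hb f, h.fibre_symm b hb f⟩, h.symm_apply, h.fibre_zero,
      h.fibre_add, h.fibre_smul⟩

theorem IsTrivialization.exists_fin [FiniteDimensional ℝ G] {V : VBStr ID D IB B} {U : Set B}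
    {φ : D → G} {ψ : B × G → D} (h : V.IsTrivialization U φ ψ) :
    ∃ (n : ℕ) (φ : D → (Fin n → ℝ)) (ψ : B × (Fin n → ℝ) → D), V.IsTrivialization U φ ψ :=
  ⟨_, _, _, h.congr_fibre (ContinuousLinearEquiv.ofFinrankEq
    (F := Fin (Module.finrank ℝ G) → ℝ) (by simp))⟩

theorem IsVectorBundle.contMDiff_zero {V : VBStr ID D IB B} (hV : V.IsVectorBundle) :
    ContMDiff IB ID ∞ V.zero := fun b ↦ by
  obtain ⟨U, n, φ, ψ, hb, h⟩ := hV.exists_isTrivialization b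
  exact h.contMDiffAt_zero hb

theorem IsVectorBundle.contMDiff_smul {V : VBStr ID D IB B} (hV : V.IsVectorBundle) (t : ℝ) :
    ContMDiff ID ID ∞ (V.smul t) := fun d ↦ by
  obtain ⟨U, n, φ, ψ, hd, h⟩ := hV.exists_isTrivialization (V.proj d)
  exact h.contMDiffAt_smul t hd

variable [IsManifold ID ∞ D] [IsManifold IB ∞ B]

theorem tangent_add (V : VBStr ID D IB B) (v w : TangentBundle ID D) :
    V.tangent.add v w = ⟨V.add v.proj w.proj, V.addDeriv v.proj w.proj (v.vec, w.vec)⟩ := rfl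

theorem tangent_proj_eq_iff (V : VBStr ID D IB B) {v w : TangentBundle ID D} :
    V.tangent.proj v = V.tangent.proj w ↔ V.proj v.proj = V.proj w.proj ∧
      mderiv ID IB V.proj v.proj v.vec = mderiv ID IB V.proj w.proj w.vec := by
  refine ⟨fun h ↦ ⟨congrArg TotalSpace.proj h, congrArg TangentBundle.vec h⟩,
    fun h ↦ TangentBundle.ext_vec h.1 h.2⟩

theorem IsVectorBundle.isFibred_tangent {V : VBStr ID D IB B} (hV : V.IsVectorBundle) :
    V.tangent.IsFibred where
  contMDiff_proj := contMDiff_tangentMap hV.contMDiff_proj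
  proj_zero β := by
    obtain ⟨U, n, φ, ψ, hb, h⟩ := hV.exists_isTrivialization β.proj
    exact TangentBundle.ext_vec (hV.proj_zero _) (h.mderiv_proj_zero hb _)
  proj_add v w hvw := by
    obtain ⟨U, n, φ, ψ, hb, h⟩ := hV.exists_isTrivialization (V.proj v.proj)
    obtain ⟨h1, h2⟩ := V.tangent_proj_eq_iff.1 hvw
    exact TangentBundle.ext_vec (hV.proj_add _ _ h1) (h.mderiv_proj_addDeriv hb h1 h2)
  proj_smul t v := by
    obtain ⟨U, n, φ, ψ, hb, h⟩ := hV.exists_isTrivialization (V.proj v.proj)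
    exact TangentBundle.ext_vec (hV.proj_smul _ _) (h.mderiv_proj_smul t hb _)

/-- The inverse of the local trivialization of the tangent prolongation which is induced by the
inverse `ψ` of a local trivialization. -/
def tangentSymm (ID : ModelWithCorners ℝ XD HD) (IB : ModelWithCorners ℝ XB HB)
    (ψ : B × G → D) (p : TangentBundle IB B × (G × G)) : TangentBundle ID D :=
  tangentMap (IB.prod 𝓘(ℝ, G)) ID ψ
    ((equivTangentBundleProd IB B 𝓘(ℝ, G) G).symm (p.1, ⟨p.2.1, p.2.2⟩))

/-- A local trivialization `(q, φ)` of `q : D → B` induces the local trivialization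
`(T(q), T(φ))` of the tangent prolongation `T(q) : TD → TB`, with model fibre `TG = G × G`. -/
theorem IsTrivialization.tangent {V : VBStr ID D IB B} {U : Set B} {φ : D → G} {ψ : B × G → D}
    (h : V.IsTrivialization U φ ψ) (hV : V.IsVectorBundle) :
    V.tangent.IsTrivialization (TotalSpace.proj ⁻¹' U) (tangentPair ID φ)
      (tangentSymm ID IB ψ) where
  toIsFibred := hV.isFibred_tangent
  isOpen := h.isOpen.preimage (contMDiff_proj (n := 0) (IB := IB) (TangentSpace IB)).continuous
  contMDiffOn_fibre := contMDiffOn_tangentPair h.contMDiffOn_fibre h.isOpen_preimage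
  contMDiffOn_symm := by
    refine (contMDiffOn_tangentMap h.contMDiffOn_symm (h.isOpen.prod isOpen_univ)).comp
      ((contMDiff_equivTangentBundleProd_symm (n := ∞)).comp
        (contMDiff_fst.prodMk (contMDiff_mk_modelSpace.comp contMDiff_snd))).contMDiffOn ?_
    rintro ⟨β, f⟩ ⟨hβ, -⟩
    exact ⟨hβ, mem_univ _⟩
  proj_symm β hβ f := TangentBundle.ext_vec (h.proj_symm _ hβ _)
    (h.mderiv_proj_symm (p := (β.proj, f.1)) hβ (β.vec, f.2))
  fibre_symm β hβ f := Prod.ext (h.fibre_symm _ hβ _)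
    (h.mderiv_fibre_symm (p := (β.proj, f.1)) hβ (β.vec, f.2))
  symm_apply v hv := TangentBundle.ext_vec (h.symm_apply _ hv) (h.mderiv_symm hv v.vec)
  fibre_zero β hβ := Prod.ext (h.fibre_zero _ hβ) (h.mderiv_fibre_zero hβ β.vec)
  fibre_add v w hv hvw := by
    obtain ⟨h1, h2⟩ := V.tangent_proj_eq_iff.1 hvw
    exact Prod.ext (h.fibre_add _ _ hv h1) (h.mderiv_fibre_addDeriv hv h1 h2)
  fibre_smul t v hv := Prod.ext (h.fibre_smul t _ hv) (h.mderiv_fibre_smul t hv v.vec)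

theorem IsVectorBundle.tangent {V : VBStr ID D IB B} (hV : V.IsVectorBundle) :
    V.tangent.IsVectorBundle := .of_isTrivialization hV.isFibred_tangent fun β ↦ by
  obtain ⟨U, n, φ, ψ, hb, h⟩ := hV.exists_isTrivialization β.proj
  obtain ⟨m, φ', ψ', h'⟩ := (h.tangent hV).exists_fin
  exact ⟨_, m, φ', ψ', hb, h'⟩

end Prolongation

section OfBundle

variable
  {XB : Type*} [NormedAddCommGroup XB] [NormedSpace ℝ XB] {HB : Type*} [TopologicalSpace HB]
  {IB : ModelWithCorners ℝ XB HB} {B : Type*} [TopologicalSpace B] [ChartedSpace HB B]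
  {F : Type*} [NormedAddCommGroup F] [NormedSpace ℝ F]
  {W : B → Type*} [TopologicalSpace (TotalSpace F W)] [∀ b, AddCommGroup (W b)]
  [∀ b, Module ℝ (W b)] [∀ b, TopologicalSpace (W b)] [FiberBundle F W]

@[simp] theorem ofBundle_add_mk (b : B) (v w : W b) :
    (ofBundle IB F W).add ⟨b, v⟩ ⟨b, w⟩ = ⟨b, v + w⟩ := by
  simp [ofBundle]

theorem isFibred_ofBundle : (ofBundle IB F W).IsFibred where
  contMDiff_proj := contMDiff_proj W
  proj_zero _ := rfl
  proj_add v w h := by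
    obtain ⟨b, v⟩ := v
    obtain ⟨b', w⟩ := w
    obtain rfl : b = b' := h
    simp [ofBundle]
  proj_smul _ _ := rfl

variable [VectorBundle ℝ F W] [ContMDiffVectorBundle ∞ F W IB]

/-- A local trivialization of a vector bundle in the sense of Mathlib. -/
theorem isTrivialization_ofBundle (e : Trivialization F (π F W)) [MemTrivializationAtlas e] :
    (ofBundle IB F W).IsTrivialization e.baseSet (fun v ↦ (e v).2)
      e.toOpenPartialHomeomorph.symm where
  toIsFibred := isFibred_ofBundle
  isOpen := e.open_baseSet
  contMDiffOn_fibre := by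
    have := contMDiff_snd.comp_contMDiffOn (e.contMDiffOn (IB := IB) (n := ∞))
    rwa [e.source_eq] at this
  contMDiffOn_symm := by
    have := e.contMDiffOn_symm (IB := IB) (n := ∞)
    rwa [e.target_eq] at this
  proj_symm b hb f := e.proj_symm_apply (e.mem_target.2 hb)
  fibre_symm b hb f := by rw [e.apply_symm_apply (e.mem_target.2 hb)]
  symm_apply v hv := e.symm_apply_mk_proj (e.mem_source.2 hv)
  fibre_zero b hb := (e.continuousLinearEquivAt ℝ b hb).map_zero
  fibre_add v w hv hvw := by
    obtain ⟨b, v⟩ := v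
    obtain ⟨b', w⟩ := w
    obtain rfl : b = b' := hvw
    rw [ofBundle_add_mk]
    exact (e.continuousLinearEquivAt ℝ b hv).map_add v w
  fibre_smul t v hv := (e.continuousLinearEquivAt ℝ v.proj hv).map_smul t v.2

theorem isVectorBundle_ofBundle [FiniteDimensional ℝ F] :
    (ofBundle IB F W).IsVectorBundle := .of_isTrivialization isFibred_ofBundle fun b ↦ by
  obtain ⟨n, φ, ψ, h⟩ := (isTrivialization_ofBundle (IB := IB) (trivializationAt F W b)).exists_fin
  exact ⟨_, n, φ, ψ, FiberBundle.mem_baseSet_trivializationAt' b, h⟩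

end OfBundle

end VBStr

/-! ### The tangent bundle and the tangent prolongation form a double vector bundle -/

namespace VBStr

section Hom

variable
  {XD : Type*} [NormedAddCommGroup XD] [NormedSpace ℝ XD] {HD : Type*} [TopologicalSpace HD]
  {ID : ModelWithCorners ℝ XD HD} {D : Type*} [TopologicalSpace D] [ChartedSpace HD D]
  {XB : Type*} [NormedAddCommGroup XB] [NormedSpace ℝ XB] {HB : Type*} [TopologicalSpace HB]
  {IB : ModelWithCorners ℝ XB HB} {B : Type*} [TopologicalSpace B] [ChartedSpace HB B]
  {XD' : Type*} [NormedAddCommGroup XD'] [NormedSpace ℝ XD'] {HD' : Type*} [TopologicalSpace HD']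
  {ID' : ModelWithCorners ℝ XD' HD'} {D' : Type*} [TopologicalSpace D'] [ChartedSpace HD' D']
  {XB' : Type*} [NormedAddCommGroup XB'] [NormedSpace ℝ XB'] {HB' : Type*} [TopologicalSpace HB']
  {IB' : ModelWithCorners ℝ XB' HB'} {B' : Type*} [TopologicalSpace B'] [ChartedSpace HB' B']
  {XD'' : Type*} [NormedAddCommGroup XD''] [NormedSpace ℝ XD'']
  {HD'' : Type*} [TopologicalSpace HD'']
  {ID'' : ModelWithCorners ℝ XD'' HD''} {D'' : Type*} [TopologicalSpace D''] [ChartedSpace HD'' D'']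
  {XB'' : Type*} [NormedAddCommGroup XB''] [NormedSpace ℝ XB'']
  {HB'' : Type*} [TopologicalSpace HB'']
  {IB'' : ModelWithCorners ℝ XB'' HB''} {B'' : Type*} [TopologicalSpace B''] [ChartedSpace HB'' B'']
  {V : VBStr ID D IB B} {V' : VBStr ID' D' IB' B'} {V'' : VBStr ID'' D'' IB'' B''}

theorem IsHom.id (V : VBStr ID D IB B) : V.IsHom V id id :=
  ⟨contMDiff_id, contMDiff_id, fun _ ↦ rfl, fun _ ↦ rfl, fun _ _ _ ↦ rfl, fun _ _ ↦ rfl⟩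

theorem IsHom.comp {Φ : D → D'} {φ : B → B'} {Ψ : D' → D''} {χ : B' → B''}
    (h' : V'.IsHom V'' Ψ χ) (h : V.IsHom V' Φ φ) : V.IsHom V'' (Ψ ∘ Φ) (χ ∘ φ) where
  contMDiff_total := h'.contMDiff_total.comp h.contMDiff_total
  contMDiff_base := h'.contMDiff_base.comp h.contMDiff_base
  map_proj d := by simp [h'.map_proj, h.map_proj]
  map_zero b := by simp [h'.map_zero, h.map_zero]
  map_add d d' hd := by
    have hd' : V'.proj (Φ d) = V'.proj (Φ d') := by rw [h.map_proj, h.map_proj, hd]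
    simp [h.map_add _ _ hd, h'.map_add _ _ hd']
  map_smul t d := by simp [h'.map_smul, h.map_smul]

/-- The inverse of a bijective morphism of vector bundles is a morphism if it is smooth. -/
theorem IsHom.symm {Φ : D → D'} {φ : B → B'} {Ψ : D' → D} {χ : B' → B}
    (h : V.IsHom V' Φ φ) (hΨ : ContMDiff ID' ID ∞ Ψ) (hχ : ContMDiff IB' IB ∞ χ)
    (h1 : Function.LeftInverse Ψ Φ) (h2 : Function.RightInverse Ψ Φ)
    (h3 : Function.LeftInverse χ φ) (h4 : Function.RightInverse χ φ) : V'.IsHom V Ψ χ where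
  contMDiff_total := hΨ
  contMDiff_base := hχ
  map_proj d := by rw [← h3 (V.proj (Ψ d)), ← h.map_proj, h2]
  map_zero b := by rw [← h1 (V.zero (χ b)), h.map_zero, h4]
  map_add d d' hd := by
    have hd' : V.proj (Ψ d) = V.proj (Ψ d') := h3.injective <| by
      rw [← h.map_proj, ← h.map_proj, h2, h2, hd]
    rw [← h1 (V.add (Ψ d) (Ψ d')), h.map_add _ _ hd', h2, h2]
  map_smul t d := by rw [← h1 (V.smul t (Ψ d)), h.map_smul, h2]

end Hom

section TangentBundle

variable
  {X : Type*} [NormedAddCommGroup X] [NormedSpace ℝ X] {H : Type*} [TopologicalSpace H]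
  {I : ModelWithCorners ℝ X H} {N : Type*} [TopologicalSpace N] [ChartedSpace H N]
  {X' : Type*} [NormedAddCommGroup X'] [NormedSpace ℝ X'] {H' : Type*} [TopologicalSpace H']
  {I' : ModelWithCorners ℝ X' H'} {N' : Type*} [TopologicalSpace N'] [ChartedSpace H' N']

theorem tangentBundle_add [IsManifold I 1 N] {v w : TangentBundle I N} (h : v.proj = w.proj) :
    (tangentBundle I N).add v w = ⟨v.proj, v.vec + w.vec⟩ := by
  obtain ⟨x, a⟩ := v
  obtain ⟨y, b⟩ := w
  obtain rfl : x = y := h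
  exact ofBundle_add_mk x a b

theorem isHom_tangentMap [IsManifold I ∞ N] [IsManifold I' ∞ N'] {f : N → N'}
    (hf : ContMDiff I I' ∞ f) :
    (tangentBundle I N).IsHom (tangentBundle I' N') (tangentMap I I' f) f where
  contMDiff_total := contMDiff_tangentMap hf
  contMDiff_base := hf
  map_proj _ := rfl
  map_zero x := TangentBundle.ext_vec rfl (map_zero (mderiv I I' f x))
  map_add v w h := by
    obtain ⟨x, a⟩ := v
    obtain ⟨y, b⟩ := w
    obtain rfl : x = y := h
    rw [tangentBundle_add (v := (⟨x, a⟩ : TangentBundle I N)) (w := ⟨x, b⟩) rfl,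
      tangentBundle_add (v := tangentMap I I' f ⟨x, a⟩) (w := tangentMap I I' f ⟨x, b⟩) rfl]
    exact TangentBundle.ext_vec rfl (map_add (mderiv I I' f x) a b)
  map_smul t v := TangentBundle.ext_vec rfl (map_smul (mderiv I I' f v.proj) t v.vec)

end TangentBundle

end VBStr

section Squares

variable
  {XD : Type*} [NormedAddCommGroup XD] [NormedSpace ℝ XD] {HD : Type*} [TopologicalSpace HD]
  {ID : ModelWithCorners ℝ XD HD} {D : Type*} [TopologicalSpace D] [ChartedSpace HD D]
  {XB : Type*} [NormedAddCommGroup XB] [NormedSpace ℝ XB] {HB : Type*} [TopologicalSpace HB]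
  {IB : ModelWithCorners ℝ XB HB} {B : Type*} [TopologicalSpace B] [ChartedSpace HB B]

open VBStr

/-- The square formed by the tangent bundle and the tangent prolongation of a vector bundle
`D → B`. -/
def VBStr.prolongationSquare [IsManifold ID 1 D] [IsManifold IB 1 B] (V : VBStr ID D IB B) :
    VBSquare ID.tangent (TangentBundle ID D) ID D IB.tangent (TangentBundle IB B) IB B where
  vDA := tangentBundle ID D
  vDB := V.tangent
  vA := V
  vB := tangentBundle IB B

variable [IsManifold ID ∞ D] [IsManifold IB ∞ B]

/-- The interchange law holds because the derivative of the addition is linear. -/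
theorem VBStr.tangent_add_tangentBundle_add (V : VBStr ID D IB B)
    {v₁ v₂ v₃ v₄ : TangentBundle ID D} (h12 : v₁.proj = v₂.proj) (h34 : v₃.proj = v₄.proj) :
    V.tangent.add ((tangentBundle ID D).add v₁ v₂) ((tangentBundle ID D).add v₃ v₄)
      = (tangentBundle ID D).add (V.tangent.add v₁ v₃) (V.tangent.add v₂ v₄) := by
  obtain ⟨x, a₁⟩ := v₁
  obtain ⟨x', a₂⟩ := v₂
  obtain rfl : x = x' := h12
  obtain ⟨y, a₃⟩ := v₃
  obtain ⟨y', a₄⟩ := v₄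
  obtain rfl : y = y' := h34
  rw [tangentBundle_add (v := (⟨x, a₁⟩ : TangentBundle ID D)) (w := ⟨x, a₂⟩) rfl,
    tangentBundle_add (v := (⟨y, a₃⟩ : TangentBundle ID D)) (w := ⟨y, a₄⟩) rfl,
    tangentBundle_add (v := V.tangent.add ⟨x, a₁⟩ ⟨y, a₃⟩)
      (w := V.tangent.add ⟨x, a₂⟩ ⟨y, a₄⟩) rfl]
  exact TangentBundle.ext_vec rfl (map_add (V.addDeriv x y) (a₁, a₃) (a₂, a₄))

theorem VBStr.IsVectorBundle.isDoubleVectorBundle_prolongationSquare [FiniteDimensional ℝ XD]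
    [FiniteDimensional ℝ XB] {V : VBStr ID D IB B} (hV : V.IsVectorBundle) :
    V.prolongationSquare.IsDoubleVectorBundle where
  isVectorBundle_DA := isVectorBundle_ofBundle
  isVectorBundle_DB := hV.tangent
  isVectorBundle_A := hV
  isVectorBundle_B := isVectorBundle_ofBundle
  isHom_projB := isHom_tangentMap hV.contMDiff_proj
  isHom_projA :=
    { contMDiff_total := Bundle.contMDiff_proj (TangentSpace ID)
      contMDiff_base := Bundle.contMDiff_proj (TangentSpace IB)
      map_proj := fun _ ↦ rfl
      map_zero := fun _ ↦ rfl
      map_add := fun _ _ _ ↦ rfl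
      map_smul := fun _ _ ↦ rfl }
  isHom_zeroA :=
    { contMDiff_total := contMDiff_zeroSection ℝ (TangentSpace ID)
      contMDiff_base := contMDiff_zeroSection ℝ (TangentSpace IB)
      map_proj := fun d ↦ TangentBundle.ext_vec rfl (map_zero (mderiv ID IB V.proj d))
      map_zero := fun b ↦ TangentBundle.ext_vec rfl (map_zero (mderiv IB ID V.zero b)).symm
      map_add := fun d d' _ ↦ TangentBundle.ext_vec rfl (map_zero (V.addDeriv d d')).symm
      map_smul := fun t d ↦ TangentBundle.ext_vec rfl (map_zero (mderiv ID ID (V.smul t) d)).symm }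
  isHom_zeroB := isHom_tangentMap hV.contMDiff_zero
  add_add _ _ _ _ h12 h34 _ _ := V.tangent_add_tangentBundle_add h12 h34
  smulA_addB t v w _ :=
    TangentBundle.ext_vec rfl (map_smul (V.addDeriv v.proj w.proj) t (v.vec, w.vec)).symm
  smulB_addA t v w h := (isHom_tangentMap (hV.contMDiff_smul t)).map_add v w h
  smul_smul s t v := ((isHom_tangentMap (hV.contMDiff_smul t)).map_smul s v).symm
  surjective d β h := by
    obtain ⟨U, n, φ, ψ, hd, h'⟩ := hV.exists_isTrivialization (V.proj d)
    obtain ⟨v, hv, -⟩ := h'.exists_mderiv hd β.vec 0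
    exact ⟨⟨d, v⟩, rfl, TangentBundle.ext_vec h hv⟩
  submersion := by
    rintro v ⟨d, α⟩ ⟨β₀, β⟩ hd hβ₀ hαβ
    obtain rfl : d = v.proj := hd
    obtain rfl : β₀ = V.tangent.proj v := hβ₀
    obtain ⟨U, n, φ, ψ, hd, h⟩ := hV.exists_isTrivialization (V.proj v.proj)
    -- In the induced trivialization of `TD → TB` the first fibre coordinate of `v` is that of
    -- `p_D v ∈ D`. So `T(p_D) δ = α` prescribes the first component of the derivative along `δ` of
    -- the fibre coordinate, and the second one is arbitrary.
    obtain ⟨δ, hδ, hδ'⟩ := (h.tangent hV).exists_mderiv (d := v) hd β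
      (mderiv ID 𝓘(ℝ, Fin n → ℝ) φ v.proj α, 0)
    have hp : ∀ w : TangentBundle ID D, MDifferentiableAt ID.tangent ID TotalSpace.proj w :=
      (Bundle.contMDiff_proj (n := 1) (IB := ID) (TangentSpace ID)).mdifferentiable (by simp)
    refine ⟨⟨v, δ⟩, rfl, TangentBundle.ext_vec rfl (h.mderiv_ext hd ?_ ?_),
      TangentBundle.ext_vec rfl hδ⟩
    · have hp' : ∀ w : TangentBundle IB B, MDifferentiableAt IB.tangent IB TotalSpace.proj w :=
        (Bundle.contMDiff_proj (n := 1) (IB := IB) (TangentSpace IB)).mdifferentiable (by simp)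
      have e1 := mderiv_comp (h.mdifferentiableAt_proj v.proj) (hp v) δ
      have e2 := mderiv_comp (hp' (V.tangent.proj v)) ((h.tangent hV).mdifferentiableAt_proj v) δ
      have e3 : mderiv ID IB V.proj v.proj α = mderiv IB.tangent IB TotalSpace.proj _ β :=
        congrArg TangentBundle.vec hαβ
      rw [hδ] at e2
      exact (e1.symm.trans e2).trans e3.symm
    · have e1 := mderiv_comp (h.mdifferentiableAt_fibre hd) (hp v) δ
      have e2 := mderiv_clm ((h.tangent hV).mdifferentiableAt_fibre hd)
        (ContinuousLinearMap.fst ℝ (Fin n → ℝ) (Fin n → ℝ)) δ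
      rw [hδ'] at e2
      exact e1.symm.trans e2

end Squares

/-! ### Second derivatives in charts -/

section Charts

variable
  {X : Type*} [NormedAddCommGroup X] [NormedSpace ℝ X] {H : Type*} [TopologicalSpace H]
  {I : ModelWithCorners ℝ X H} {N : Type*} [TopologicalSpace N] [ChartedSpace H N]
  {X' : Type*} [NormedAddCommGroup X'] [NormedSpace ℝ X'] {H' : Type*} [TopologicalSpace H']
  {I' : ModelWithCorners ℝ X' H'} {N' : Type*} [TopologicalSpace N'] [ChartedSpace H' N']
  {G : Type*} [NormedAddCommGroup G] [NormedSpace ℝ G]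

theorem mderiv_extChartAt_self [IsManifold I 1 N] (x : N) :
    mderiv I 𝓘(ℝ, X) (extChartAt I x) x = ContinuousLinearMap.id ℝ X :=
  mfderiv_extChartAt_self

theorem snd_trivializationAt_tangentSpace [IsManifold I 1 N] {x : N} {z : TangentBundle I N}
    (hz : z.proj ∈ (chartAt H x).source) :
    (trivializationAt X (TangentSpace I) x z).2
      = mderiv I 𝓘(ℝ, X) (extChartAt I x) z.proj z.vec := by
  have h := TangentBundle.continuousLinearMapAt_trivializationAt (I := I) hz
  have h' := congrArg (fun L : X →L[ℝ] X ↦ L z.vec) h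
  refine Eq.trans ?_ h'
  exact (Trivialization.continuousLinearMapAt_apply_of_mem (R := ℝ)
    (trivializationAt X (TangentSpace I) x) hz z.2).symm

/-- The preferred charts of `TN` are the tangent maps of the preferred charts of `N`. -/
theorem extChartAt_tangent_apply [IsManifold I 1 N] {p z : TangentBundle I N}
    (hz : z.proj ∈ (chartAt H p.proj).source) :
    extChartAt I.tangent p z = tangentPair I (extChartAt I p.proj) z := by
  rw [ModelWithCorners.tangent, FiberBundle.extChartAt]
  exact Prod.ext rfl (snd_trivializationAt_tangentSpace hz)

theorem extChartAt_tangent_self [IsManifold I 1 N] (p : TangentBundle I N) :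
    extChartAt I.tangent p p = (extChartAt I p.proj p.proj, p.vec) := by
  rw [extChartAt_tangent_apply (mem_chart_source H _), tangentPair, mderiv_extChartAt_self]
  rfl

theorem mdifferentiableAt_tangentPair [IsManifold I ∞ N] {f : N → G} {v : TangentBundle I N}
    {s : Set N} (hf : ContMDiffOn I 𝓘(ℝ, G) ∞ f s) (hs : IsOpen s) (hv : v.proj ∈ s) :
    MDifferentiableAt I.tangent 𝓘(ℝ, G × G) (tangentPair I f) v :=
  (((contMDiffOn_tangentPair hf hs) v hv).contMDiffAt
    ((hs.preimage (contMDiff_proj (n := 0) (IB := I) (TangentSpace I)).continuous).mem_nhds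
      hv)).mdifferentiableAt (by simp)

theorem preimage_proj_mem_nhds [IsManifold I 1 N] {s : Set N} {v : TangentBundle I N}
    (hs : s ∈ 𝓝 v.proj) : TotalSpace.proj ⁻¹' s ∈ 𝓝 v :=
  (contMDiff_proj (n := 0) (IB := I) (TangentSpace I)).continuous.continuousAt hs

/-- The preferred charts of `T²N` are the second tangent maps of the preferred charts of `N`. -/
theorem extChartAt_tangent_tangent_apply [IsManifold I ∞ N]
    {q ζ : TangentBundle I.tangent (TangentBundle I N)}
    (hζ : ζ.proj.proj ∈ (chartAt H q.proj.proj).source) :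
    extChartAt I.tangent.tangent q ζ
      = tangentPair I.tangent (tangentPair I (extChartAt I q.proj.proj)) ζ := by
  rw [extChartAt_tangent_apply ((TangentBundle.mem_chart_source_iff _ _).2 hζ)]
  refine tangentPair_congr ?_
  filter_upwards [preimage_proj_mem_nhds ((chartAt H q.proj.proj).open_source.mem_nhds hζ)]
    with z hz using extChartAt_tangent_apply hz

/-- A point of `T²N` is determined by its coordinates. -/
theorem eq_of_tangentPair_tangentPair_eq [IsManifold I ∞ N] {x : N}
    {ζ ζ' : TangentBundle I.tangent (TangentBundle I N)}
    (hζ : ζ.proj.proj ∈ (chartAt H x).source) (hζ' : ζ'.proj.proj ∈ (chartAt H x).source)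
    (h : tangentPair I.tangent (tangentPair I (extChartAt I x)) ζ
      = tangentPair I.tangent (tangentPair I (extChartAt I x)) ζ') : ζ = ζ' := by
  set q : TangentBundle I.tangent (TangentBundle I N) := ⟨⟨x, 0⟩, 0⟩
  have hs : ∀ ζ : TangentBundle I.tangent (TangentBundle I N),
      ζ.proj.proj ∈ (chartAt H x).source → ζ ∈ (extChartAt I.tangent.tangent q).source := by
    intro ζ hζ
    rw [extChartAt_source, TangentBundle.mem_chart_source_iff, TangentBundle.mem_chart_source_iff]
    exact hζ
  refine (extChartAt I.tangent.tangent q).injOn (hs ζ hζ) (hs ζ' hζ') ?_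
  rw [extChartAt_tangent_tangent_apply (q := q) hζ, extChartAt_tangent_tangent_apply (q := q) hζ']
  exact h

/-- The derivative of a tangent map `(y, u) ↦ (f y, f' y u)` between vector spaces. -/
theorem hasFDerivAt_tangentPair {f : X → G} {y u : X} (hf : ContDiffAt ℝ ∞ f y) :
    HasFDerivAt (fun p : X × X ↦ (f p.1, fderiv ℝ f p.1 p.2))
      (((fderiv ℝ f y).comp (ContinuousLinearMap.fst ℝ X X)).prod
        (((fderiv ℝ (fderiv ℝ f) y).flip u).comp (ContinuousLinearMap.fst ℝ X X)
          + (fderiv ℝ f y).comp (ContinuousLinearMap.snd ℝ X X))) (y, u) := by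
  have h1 : HasFDerivAt f (fderiv ℝ f y) y := (hf.differentiableAt (by simp)).hasFDerivAt
  have h2 : HasFDerivAt (fderiv ℝ f) (fderiv ℝ (fderiv ℝ f) y) y :=
    ((hf.fderiv_right (m := 1) (by norm_cast)).differentiableAt (by simp)).hasFDerivAt
  have h3 := HasFDerivAt.comp (y, u) (f := Prod.fst) h1 hasFDerivAt_fst
  have h4 := HasFDerivAt.comp (y, u) (f := Prod.fst) h2 hasFDerivAt_fst
  have h5 := h4.clm_apply (hasFDerivAt_snd (𝕜 := ℝ) (p := (y, u)))
  refine (h3.prodMk h5).congr_fderiv ?_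
  ext v <;> simp

/-- The second tangent map of `f : N → G` in coordinates: with `L` and `Q` the first and second
derivatives of `f` in the preferred chart at `x`, it is
`(x, a; b, c) ↦ (f x, L a; L b, Q b a + L c)`. -/
theorem exists_tangentPair_tangentPair [I.Boundaryless] [IsManifold I ∞ N] {f : N → G} {s : Set N}
    (hf : ContMDiffOn I 𝓘(ℝ, G) ∞ f s) (hs : IsOpen s) {x : N} (hx : x ∈ s) :
    ∃ (L : X →L[ℝ] G) (Q : X →L[ℝ] X →L[ℝ] G), (∀ a b, Q a b = Q b a) ∧
      ∀ ζ : TangentBundle I.tangent (TangentBundle I N), ζ.proj.proj = x →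
        tangentPair I.tangent (tangentPair I f) ζ
          = ((f x, L ζ.proj.vec), (L ζ.vec.1, Q ζ.vec.1 ζ.proj.vec + L ζ.vec.2)) := by
  set e := extChartAt I x with he
  set F : X → G := fun y ↦ f (e.symm y) with hF
  have hx' : e.symm (e x) = x := extChartAt_to_inv x
  have hsymm : ContMDiffAt 𝓘(ℝ, X) I ∞ e.symm (e x) :=
    (contMDiffOn_extChartAt_symm x _ (mem_extChartAt_target x)).contMDiffAt
      (extChartAt_target_mem_nhds x)
  have hfx : ContMDiffAt I 𝓘(ℝ, G) ∞ f (e.symm (e x)) := by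
    rw [hx']
    exact (hf x hx).contMDiffAt (hs.mem_nhds hx)
  have hFs : ContMDiffAt 𝓘(ℝ, X) 𝓘(ℝ, G) ∞ F (e x) := ContMDiffAt.comp (e x) hfx hsymm
  have hFc : ContDiffAt ℝ ∞ F (e x) := hFs.contDiffAt
  -- `f` is `F` in the chart, so `T(f)` is `T(F)` in the induced chart.
  have key : ∀ z : TangentBundle I N, z.proj ∈ (chartAt H x).source ∩ s →
      tangentPair I f z = ((F (tangentPair I e z).1,
        fderiv ℝ F (tangentPair I e z).1 (tangentPair I e z).2) : G × G) := by
    rintro z ⟨hz, hzs⟩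
    have hz' : z.proj ∈ e.source := by rwa [he, extChartAt_source]
    have hzz : e.symm (e z.proj) = z.proj := e.left_inv hz'
    have hFz : MDifferentiableAt 𝓘(ℝ, X) 𝓘(ℝ, G) F (e z.proj) := by
      have h1 : ContMDiffAt 𝓘(ℝ, X) I ∞ e.symm (e z.proj) :=
        (contMDiffOn_extChartAt_symm x _ (e.map_source hz')).contMDiffAt
          ((isOpen_extChartAt_target x).mem_nhds (e.map_source hz'))
      have h2 : ContMDiffAt I 𝓘(ℝ, G) ∞ f (e.symm (e z.proj)) := by
        rw [hzz]
        exact (hf _ hzs).contMDiffAt (hs.mem_nhds hzs)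
      exact (ContMDiffAt.comp (e z.proj) h2 h1).mdifferentiableAt (by simp)
    have hez : MDifferentiableAt I 𝓘(ℝ, X) e z.proj := mdifferentiableAt_extChartAt hz
    have hcongr : f =ᶠ[𝓝 z.proj] fun y ↦ F (e y) := by
      filter_upwards [(chartAt H x).open_source.mem_nhds hz] with y hy
      rw [hF]
      simp only
      rw [e.left_inv (by rwa [he, extChartAt_source])]
    rw [tangentPair_congr hcongr]
    refine Prod.ext rfl ((mderiv_comp hFz hez _).trans ?_)
    exact congrArg (fun L : X →L[ℝ] G ↦ L _) mfderiv_eq_fderiv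
  refine ⟨fderiv ℝ F (e x), fderiv ℝ (fderiv ℝ F) (e x), ?_, ?_⟩
  · have : IsSymmSndFDerivAt ℝ F (e x) := hFc.isSymmSndFDerivAt (by
      simp only [minSmoothness_of_isRCLikeNormedField]
      exact ENat.LEInfty.out)
    exact fun a b ↦ this a b
  · intro ζ hζ
    obtain ⟨p, w⟩ := ζ
    change p.proj = x at hζ
    subst hζ
    have hmem : p.proj ∈ (chartAt H p.proj).source ∩ s := ⟨mem_chart_source H _, hx⟩
    have hev : tangentPair I f =ᶠ[𝓝 p] fun z ↦ (fun q : X × X ↦ (F q.1, fderiv ℝ F q.1 q.2))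
        (extChartAt I.tangent p z) := by
      filter_upwards [preimage_proj_mem_nhds
        (((chartAt H p.proj).open_source.inter hs).mem_nhds hmem)] with z hz
      rw [key z hz, extChartAt_tangent_apply hz.1]
    rw [tangentPair_congr hev]
    have hd := hasFDerivAt_tangentPair (u := p.vec) hFc
    rw [← extChartAt_tangent_self] at hd
    have hmd := mderiv_comp (x := p) (g := fun q : X × X ↦ (F q.1, fderiv ℝ F q.1 q.2))
      hd.differentiableAt.mdifferentiableAt
      (mdifferentiableAt_extChartAt (I := I.tangent) (mem_chart_source _ p)) w
    have hd' := congrArg (fun L : X × X →L[ℝ] G × G ↦ L w)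
      ((mfderiv_eq_fderiv (𝕜 := ℝ)).trans hd.fderiv)
    rw [mderiv_extChartAt_self] at hmd
    refine Prod.ext ?_ ?_
    · change (_, _) = (_, _)
      simp only [extChartAt_tangent_self]
      rw [hF]
      simp only
      rw [hx']
    · exact hmd.trans hd'

end Charts

/-! ### The canonical involution -/

section Involution

variable
  {X : Type*} [NormedAddCommGroup X] [NormedSpace ℝ X] {H : Type*} [TopologicalSpace H]
  {I : ModelWithCorners ℝ X H} {N : Type*} [TopologicalSpace N] [ChartedSpace H N]
  {X' : Type*} [NormedAddCommGroup X'] [NormedSpace ℝ X'] {H' : Type*} [TopologicalSpace H']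
  {I' : ModelWithCorners ℝ X' H'} {N' : Type*} [TopologicalSpace N'] [ChartedSpace H' N']
  {G : Type*} [NormedAddCommGroup G] [NormedSpace ℝ G]

/-- The map `(x, a; b, c) ↦ (x, b; a, c)`, which is the canonical involution of a vector space. -/
def middleSwap (G : Type*) [NormedAddCommGroup G] [NormedSpace ℝ G] :
    (G × G) × (G × G) →L[ℝ] (G × G) × (G × G) :=
  (((ContinuousLinearMap.fst ℝ G G).comp (ContinuousLinearMap.fst ℝ _ _)).prod
    ((ContinuousLinearMap.fst ℝ G G).comp (ContinuousLinearMap.snd ℝ _ _))).prod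
  (((ContinuousLinearMap.snd ℝ G G).comp (ContinuousLinearMap.fst ℝ _ _)).prod
    ((ContinuousLinearMap.snd ℝ G G).comp (ContinuousLinearMap.snd ℝ _ _)))

@[simp] theorem middleSwap_apply (x a b c : G) :
    middleSwap G ((x, a), (b, c)) = ((x, b), (a, c)) := rfl

theorem canonicalInvolution_canonicalInvolution [IsManifold I 1 N]
    (ζ : TangentBundle I.tangent (TangentBundle I N)) :
    canonicalInvolution I N (canonicalInvolution I N ζ) = ζ := rfl

/-- The second tangent map of a vector-valued map intertwines the canonical involutions, because
second derivatives are symmetric. -/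
theorem tangentPair_tangentPair_canonicalInvolution [I.Boundaryless] [IsManifold I ∞ N] {f : N → G}
    {s : Set N} (hf : ContMDiffOn I 𝓘(ℝ, G) ∞ f s) (hs : IsOpen s)
    {ζ : TangentBundle I.tangent (TangentBundle I N)} (hζ : ζ.proj.proj ∈ s) :
    tangentPair I.tangent (tangentPair I f) (canonicalInvolution I N ζ)
      = middleSwap G (tangentPair I.tangent (tangentPair I f) ζ) := by
  obtain ⟨L, Q, hQ, h⟩ := exists_tangentPair_tangentPair hf hs hζ
  rw [h ζ rfl, h (canonicalInvolution I N ζ) rfl, middleSwap_apply, hQ]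
  rfl

theorem contMDiffOn_extChartAt_source [IsManifold I ∞ N] (x : N) :
    ContMDiffOn I 𝓘(ℝ, X) ∞ (extChartAt I x) (chartAt H x).source :=
  contMDiffOn_extChartAt

theorem contMDiff_canonicalInvolution [I.Boundaryless] [IsManifold I ∞ N] :
    ContMDiff I.tangent.tangent I.tangent.tangent ∞ (canonicalInvolution I N) := by
  intro ζ
  have hb : I.tangent.tangent.Boundaryless := by
    unfold ModelWithCorners.tangent
    infer_instance
  have hmem : ∀ ξ : TangentBundle I.tangent (TangentBundle I N),
      ξ.proj.proj ∈ (chartAt H ζ.proj.proj).source →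
        ξ ∈ (extChartAt I.tangent.tangent ζ).source := by
    intro ξ hξ
    rw [extChartAt_source, TangentBundle.mem_chart_source_iff, TangentBundle.mem_chart_source_iff]
    exact hξ
  set E := extChartAt I.tangent.tangent ζ with hE
  -- In the charts the involution is the linear map `middleSwap`.
  have hswap : ∀ ξ : TangentBundle I.tangent (TangentBundle I N),
      ξ.proj.proj ∈ (chartAt H ζ.proj.proj).source →
        E (canonicalInvolution I N ξ) = middleSwap X (E ξ) := by
    intro ξ hξ
    rw [hE, extChartAt_tangent_tangent_apply (ζ := canonicalInvolution I N ξ) hξ,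
      extChartAt_tangent_tangent_apply hξ]
    exact tangentPair_tangentPair_canonicalInvolution (contMDiffOn_extChartAt_source _)
      (chartAt H ζ.proj.proj).open_source hξ
  have hζ : ζ.proj.proj ∈ (chartAt H ζ.proj.proj).source := mem_chart_source H _
  have h1 : ContMDiffAt I.tangent.tangent 𝓘(ℝ, (X × X) × (X × X)) ∞ E ζ := contMDiffAt_extChartAt
  have h2 : ContMDiffAt 𝓘(ℝ, (X × X) × (X × X)) I.tangent.tangent ∞ E.symm
      (middleSwap X (E ζ)) := by
    have ht : middleSwap X (E ζ) ∈ E.target := by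
      rw [← hswap ζ hζ]
      exact E.map_source (hmem _ hζ)
    exact (contMDiffOn_extChartAt_symm ζ _ ht).contMDiffAt
      ((isOpen_extChartAt_target ζ).mem_nhds ht)
  have h3 := h2.comp ζ ((middleSwap X).contDiff.contMDiff.contMDiffAt.comp ζ h1)
  refine h3.congr_of_eventuallyEq ?_
  filter_upwards [preimage_proj_mem_nhds (preimage_proj_mem_nhds
    ((chartAt H ζ.proj.proj).open_source.mem_nhds hζ))] with ξ hξ
  rw [← E.left_inv (hmem (canonicalInvolution I N ξ) hξ), hswap ξ hξ]
  rfl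

/-- The canonical involution is natural. -/
theorem canonicalInvolution_tangentMap_tangentMap [I.Boundaryless] [I'.Boundaryless]
    [IsManifold I ∞ N] [IsManifold I' ∞ N'] {h : N → N'} (hh : ContMDiff I I' ∞ h)
    (ζ : TangentBundle I.tangent (TangentBundle I N)) :
    canonicalInvolution I' N' (tangentMap I.tangent I'.tangent (tangentMap I I' h) ζ)
      = tangentMap I.tangent I'.tangent (tangentMap I I' h) (canonicalInvolution I N ζ) := by
  set y := h ζ.proj.proj with hy
  set s := (chartAt H' y).source with hs
  have hso : IsOpen s := (chartAt H' y).open_source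
  have hys : y ∈ s := mem_chart_source H' y
  have he : ContMDiffOn I' 𝓘(ℝ, X') ∞ (extChartAt I' y) s := contMDiffOn_extChartAt_source y
  have hhs : IsOpen (h ⁻¹' s) := hso.preimage hh.continuous
  have heh : ContMDiffOn I 𝓘(ℝ, X') ∞ (fun x ↦ extChartAt I' y (h x)) (h ⁻¹' s) :=
    he.comp hh.contMDiffOn fun _ hx ↦ hx
  have hfun : ∀ ξ : TangentBundle I.tangent (TangentBundle I N), h ξ.proj.proj ∈ s →
      tangentPair I'.tangent (tangentPair I' (extChartAt I' y))
        (tangentMap I.tangent I'.tangent (tangentMap I I' h) ξ)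
      = tangentPair I.tangent (tangentPair I fun x ↦ extChartAt I' y (h x)) ξ := by
    intro ξ hξ
    rw [← tangentPair_comp
      (mdifferentiableAt_tangentPair (v := tangentMap I I' h ξ.proj) he hso hξ)
      ((contMDiff_tangentMap hh).mdifferentiableAt (by simp))]
    refine tangentPair_congr ?_
    filter_upwards [preimage_proj_mem_nhds (hhs.mem_nhds hξ)] with z hz
    exact (tangentPair_comp (((he _ hz).contMDiffAt (hso.mem_nhds hz)).mdifferentiableAt (by simp))
      (hh.mdifferentiableAt (by simp))).symm
  refine eq_of_tangentPair_tangentPair_eq (x := y) hys hys ?_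
  rw [tangentPair_tangentPair_canonicalInvolution he hso hys, hfun ζ hys,
    hfun (canonicalInvolution I N ζ) hys,
    tangentPair_tangentPair_canonicalInvolution heh hhs hys]

end Involution

section TangentBundleProlongation

variable
  {X : Type*} [NormedAddCommGroup X] [NormedSpace ℝ X] {H : Type*} [TopologicalSpace H]
  {I : ModelWithCorners ℝ X H} {N : Type*} [TopologicalSpace N] [ChartedSpace H N]
  [IsManifold I ∞ N]

open VBStr

theorem contMDiffAt_tangentBundle_proj (p : TangentBundle I N) :
    ContMDiffAt I.tangent I ∞ (TotalSpace.proj : TangentBundle I N → N) p :=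
  contMDiff_proj (TangentSpace I) p

theorem isTrivialization_tangentBundle (x : N) :
    (tangentBundle I N).IsTrivialization (chartAt H x).source
      (fun v ↦ (trivializationAt X (TangentSpace I) x v).2)
      (trivializationAt X (TangentSpace I) x).toOpenPartialHomeomorph.symm :=
  isTrivialization_ofBundle (trivializationAt X (TangentSpace I) x)

theorem snd_trivializationAt_self (p : TangentBundle I N) :
    (trivializationAt X (TangentSpace I) p.proj p).2 = p.vec := by
  rw [snd_trivializationAt_tangentSpace (mem_chart_source H _), mderiv_extChartAt_self]
  rfl

theorem mderiv_tangentBundle_proj (p : TangentBundle I N) (w : X × X) :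
    mderiv I.tangent I TotalSpace.proj p w = w.1 := by
  have h := mderiv_clm (mdifferentiableAt_extChartAt (I := I.tangent) (mem_chart_source _ p))
    (ContinuousLinearMap.fst ℝ X X) w
  rw [mderiv_extChartAt_self, mderiv_congr (g := fun z ↦ extChartAt I p.proj z.proj),
    mderiv_comp (mdifferentiableAt_extChartAt (mem_chart_source H _))
      ((contMDiffAt_tangentBundle_proj p).mdifferentiableAt (by simp)),
    mderiv_extChartAt_self] at h
  · exact h
  · filter_upwards [preimage_proj_mem_nhds
      ((chartAt H p.proj).open_source.mem_nhds (mem_chart_source H _))] with z hz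
    rw [extChartAt_tangent_apply hz]
    rfl

theorem mderiv_snd_trivializationAt (p : TangentBundle I N) (w : X × X) :
    mderiv I.tangent 𝓘(ℝ, X) (fun v ↦ (trivializationAt X (TangentSpace I) p.proj v).2) p w
      = w.2 := by
  have h := mderiv_clm (mdifferentiableAt_extChartAt (I := I.tangent) (mem_chart_source _ p))
    (ContinuousLinearMap.snd ℝ X X) w
  rw [mderiv_extChartAt_self] at h
  refine Eq.trans ?_ h
  rw [mderiv_congr]
  filter_upwards [preimage_proj_mem_nhds
    ((chartAt H p.proj).open_source.mem_nhds (mem_chart_source H _))] with z hz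
  rw [extChartAt_tangent_apply hz, snd_trivializationAt_tangentSpace hz]
  rfl

/-- Coordinates of a tangent vector of `TN`: its image under the tangent map of the projection, and
the derivative of the fibre coordinate. -/
theorem eq_of_mderiv_trivializationAt {x : N} {p : TangentBundle I N} (hp : p.proj = x) {w : X × X}
    {b c : X} (h1 : mderiv I.tangent I TotalSpace.proj p w = b)
    (h2 : mderiv I.tangent 𝓘(ℝ, X) (fun v ↦ (trivializationAt X (TangentSpace I) x v).2) p w = c) :
    w = (b, c) := by
  subst hp
  rw [mderiv_tangentBundle_proj] at h1
  rw [mderiv_snd_trivializationAt] at h2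
  exact Prod.ext h1 h2

/-! The operations of the tangent prolongation of `TN → N` in coordinates. -/

theorem mderiv_tangentBundle_zero (x : N) (a : X) :
    mderiv I I.tangent (tangentBundle I N).zero x a = ((a, 0) : X × X) :=
  eq_of_mderiv_trivializationAt rfl
    ((isTrivialization_tangentBundle x).mderiv_proj_zero (mem_chart_source H x) a)
    ((isTrivialization_tangentBundle x).mderiv_fibre_zero (mem_chart_source H x) a)

theorem mderiv_tangentBundle_smul (t : ℝ) (p : TangentBundle I N) (b c : X) :
    mderiv I.tangent I.tangent ((tangentBundle I N).smul t) p (b, c) = ((b, t • c) : X × X) := by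
  refine eq_of_mderiv_trivializationAt (x := p.proj) (p := (tangentBundle I N).smul t p) rfl ?_ ?_
  · exact ((isTrivialization_tangentBundle p.proj).mderiv_proj_smul t (mem_chart_source H _)
      (b, c)).trans (mderiv_tangentBundle_proj p _)
  · exact ((isTrivialization_tangentBundle p.proj).mderiv_fibre_smul t (mem_chart_source H _)
      (b, c)).trans (congrArg _ (mderiv_snd_trivializationAt p _))

theorem addDeriv_tangentBundle {p p' : TangentBundle I N} (h : p.proj = p'.proj) (b c c' : X) :
    (tangentBundle I N).addDeriv p p' ((b, c), (b, c')) = ((b, c + c') : X × X) := by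
  have hT := isTrivialization_tangentBundle (I := I) p.proj
  have hb : mderiv I.tangent I (tangentBundle I N).proj p (b, c)
      = mderiv I.tangent I (tangentBundle I N).proj p' (b, c') :=
    (mderiv_tangentBundle_proj p _).trans (mderiv_tangentBundle_proj p' (b, c')).symm
  refine eq_of_mderiv_trivializationAt (hT.proj_add p p' h) ?_ ?_
  · exact (hT.mderiv_proj_addDeriv (mem_chart_source H _) h hb).trans
      (mderiv_tangentBundle_proj p _)
  · refine (hT.mderiv_fibre_addDeriv (mem_chart_source H _) h hb).trans ?_
    have e := mderiv_snd_trivializationAt p' (b, c')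
    rw [← h] at e
    exact congrArg₂ _ (mderiv_snd_trivializationAt p _) e

/-- The canonical involution carries the tangent bundle of `TN` to the tangent prolongation of
`TN → N`. -/
theorem isHom_canonicalInvolution [I.Boundaryless] :
    (tangentBundle I.tangent (TangentBundle I N)).IsHom (tangentBundle I N).tangent
      (canonicalInvolution I N) id where
  contMDiff_total := contMDiff_canonicalInvolution
  contMDiff_base := contMDiff_id
  map_proj ζ := TangentBundle.ext_vec rfl (mderiv_tangentBundle_proj _ _)
  map_zero p := TangentBundle.ext_vec rfl (mderiv_tangentBundle_zero p.proj p.vec).symm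
  map_add ζ ζ' h := by
    obtain ⟨p, b, c⟩ := ζ
    obtain ⟨p', b', c'⟩ := ζ'
    obtain rfl : p = p' := h
    rw [tangentBundle_add (v := (⟨p, (b, c)⟩ : TangentBundle I.tangent (TangentBundle I N)))
      (w := ⟨p, (b', c')⟩) rfl, tangent_add]
    exact TangentBundle.ext_vec
      (tangentBundle_add (v := (⟨p.proj, b⟩ : TangentBundle I N)) (w := ⟨p.proj, b'⟩) rfl).symm
      (addDeriv_tangentBundle (p := ⟨p.proj, b⟩) (p' := ⟨p.proj, b'⟩) rfl p.vec c c').symm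
  map_smul t ζ := TangentBundle.ext_vec rfl
    (mderiv_tangentBundle_smul t ⟨ζ.proj.proj, ζ.vec.1⟩ ζ.proj.vec ζ.vec.2).symm

theorem isHom_canonicalInvolution_symm [I.Boundaryless] :
    (tangentBundle I N).tangent.IsHom (tangentBundle I.tangent (TangentBundle I N))
      (canonicalInvolution I N) id :=
  isHom_canonicalInvolution.symm contMDiff_canonicalInvolution contMDiff_id
    canonicalInvolution_canonicalInvolution canonicalInvolution_canonicalInvolution
    (fun _ ↦ rfl) (fun _ ↦ rfl)

end TangentBundleProlongation

section DoubleProlongation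

variable
  {XD : Type*} [NormedAddCommGroup XD] [NormedSpace ℝ XD] {HD : Type*} [TopologicalSpace HD]
  {ID : ModelWithCorners ℝ XD HD} {D : Type*} [TopologicalSpace D] [ChartedSpace HD D]
  {XB : Type*} [NormedAddCommGroup XB] [NormedSpace ℝ XB] {HB : Type*} [TopologicalSpace HB]
  {IB : ModelWithCorners ℝ XB HB} {B : Type*} [TopologicalSpace B] [ChartedSpace HB B]
  [ID.Boundaryless] [IB.Boundaryless] [IsManifold ID ∞ D] [IsManifold IB ∞ B]

/-- The canonical involution is an automorphism of the double tangent prolongation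
`T²(q) : T²D → T²B`, by naturality for `q`, the zero section, the scalar multiplications and the
fibre coordinates. -/
theorem VBStr.IsVectorBundle.isHom_tangent_tangent {V : VBStr ID D IB B} (hV : V.IsVectorBundle) :
    V.tangent.tangent.IsHom V.tangent.tangent (canonicalInvolution ID D)
      (canonicalInvolution IB B) where
  contMDiff_total := contMDiff_canonicalInvolution
  contMDiff_base := contMDiff_canonicalInvolution
  map_proj ζ := (canonicalInvolution_tangentMap_tangentMap hV.contMDiff_proj ζ).symm
  map_zero β := canonicalInvolution_tangentMap_tangentMap hV.contMDiff_zero β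
  map_smul t ζ := canonicalInvolution_tangentMap_tangentMap (hV.contMDiff_smul t) ζ
  map_add ζ ζ' h := by
    obtain ⟨U, n, φ, ψ, hU, hT⟩ := hV.exists_isTrivialization (V.proj ζ.proj.proj)
    have hTT := (hT.tangent hV).tangent hV.tangent
    have hF := hTT.toIsFibred
    have hJ : ∀ ξ : TangentBundle ID.tangent (TangentBundle ID D),
        V.tangent.tangent.proj (canonicalInvolution ID D ξ)
          = canonicalInvolution IB B (V.tangent.tangent.proj ξ) := fun ξ ↦
      (canonicalInvolution_tangentMap_tangentMap hV.contMDiff_proj ξ).symm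
    have hJφ : ∀ ξ : TangentBundle ID.tangent (TangentBundle ID D), V.proj ξ.proj.proj ∈ U →
        tangentPair ID.tangent (tangentPair ID φ) (canonicalInvolution ID D ξ)
          = middleSwap _ (tangentPair ID.tangent (tangentPair ID φ) ξ) := fun ξ hξ ↦
      tangentPair_tangentPair_canonicalInvolution hT.contMDiffOn_fibre hT.isOpen_preimage hξ
    have hh : V.tangent.tangent.proj (canonicalInvolution ID D ζ)
        = V.tangent.tangent.proj (canonicalInvolution ID D ζ') := by rw [hJ, hJ, h]
    have hadd : V.tangent.tangent.proj (V.tangent.tangent.add ζ ζ') = V.tangent.tangent.proj ζ :=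
      hF.proj_add _ _ h
    have hUadd : V.proj (V.tangent.tangent.add ζ ζ').proj.proj ∈ U := by
      have := congrArg (fun β ↦ β.proj.proj) hadd
      change V.proj (V.tangent.tangent.add ζ ζ').proj.proj = V.proj ζ.proj.proj at this
      rwa [this]
    have hU' : V.proj ζ'.proj.proj ∈ U := by
      have := congrArg (fun β ↦ β.proj.proj) h
      change V.proj ζ.proj.proj = V.proj ζ'.proj.proj at this
      rwa [← this]
    refine hTT.ext ?_ ?_ ?_
    · rw [hJ, hadd]
      exact hU
    · rw [hJ, hadd, hF.proj_add _ _ hh, hJ]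
    · rw [hJφ _ hUadd, hTT.fibre_add _ _ hU h, map_add, ← hJφ ζ hU, ← hJφ ζ' hU']
      exact (hTT.fibre_add (canonicalInvolution ID D ζ) (canonicalInvolution ID D ζ') hU hh).symm

end DoubleProlongation

/-! ### Transport of double vector bundles along isomorphisms -/

section Functoriality

variable
  {X : Type*} [NormedAddCommGroup X] [NormedSpace ℝ X] {H : Type*} [TopologicalSpace H]
  {I : ModelWithCorners ℝ X H} {N : Type*} [TopologicalSpace N] [ChartedSpace H N]
  {X' : Type*} [NormedAddCommGroup X'] [NormedSpace ℝ X'] {H' : Type*} [TopologicalSpace H']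
  {I' : ModelWithCorners ℝ X' H'} {N' : Type*} [TopologicalSpace N'] [ChartedSpace H' N']
  {Y : Type*} [NormedAddCommGroup Y] [NormedSpace ℝ Y] {K : Type*} [TopologicalSpace K]
  {J : ModelWithCorners ℝ Y K} {P : Type*} [TopologicalSpace P] [ChartedSpace K P]
  {Y' : Type*} [NormedAddCommGroup Y'] [NormedSpace ℝ Y'] {K' : Type*} [TopologicalSpace K']
  {J' : ModelWithCorners ℝ Y' K'} {P' : Type*} [TopologicalSpace P'] [ChartedSpace K' P']

/-- The tangent functor preserves commutative squares. -/
theorem tangentMap_comm {k : N' → P'} {f : N → N'} {l : P → P'} {m : N → P}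
    (hk : ContMDiff I' J' ∞ k) (hf : ContMDiff I I' ∞ f) (hl : ContMDiff J J' ∞ l)
    (hm : ContMDiff I J ∞ m) (h : ∀ x, k (f x) = l (m x)) (v : TangentBundle I N) :
    tangentMap I' J' k (tangentMap I I' f v) = tangentMap J J' l (tangentMap I J m v) := by
  rw [← tangentMap_comp_apply (hk.mdifferentiableAt (by simp)) (hf.mdifferentiableAt (by simp)),
    ← tangentMap_comp_apply (hl.mdifferentiableAt (by simp)) (hm.mdifferentiableAt (by simp)),
    funext h]

theorem tangentMap_leftInverse {g : N' → N} {f : N → N'} (hg : ContMDiff I' I ∞ g)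
    (hf : ContMDiff I I' ∞ f) (h : Function.LeftInverse g f) (v : TangentBundle I N) :
    tangentMap I' I g (tangentMap I I' f v) = v := by
  rw [← tangentMap_comp_apply (hg.mdifferentiableAt (by simp)) (hf.mdifferentiableAt (by simp)),
    funext h]
  exact congrFun tangentMap_id v

end Functoriality

namespace VBSquare

section Transport

variable
  {XD : Type*} [NormedAddCommGroup XD] [NormedSpace ℝ XD] {HD : Type*} [TopologicalSpace HD]
  {ID : ModelWithCorners ℝ XD HD} {D : Type*} [TopologicalSpace D] [ChartedSpace HD D]
  {XA : Type*} [NormedAddCommGroup XA] [NormedSpace ℝ XA] {HA : Type*} [TopologicalSpace HA]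
  {IA : ModelWithCorners ℝ XA HA} {A : Type*} [TopologicalSpace A] [ChartedSpace HA A]
  {XB : Type*} [NormedAddCommGroup XB] [NormedSpace ℝ XB] {HB : Type*} [TopologicalSpace HB]
  {IB : ModelWithCorners ℝ XB HB} {B : Type*} [TopologicalSpace B] [ChartedSpace HB B]
  {XM : Type*} [NormedAddCommGroup XM] [NormedSpace ℝ XM] {HM : Type*} [TopologicalSpace HM]
  {IM : ModelWithCorners ℝ XM HM} {M : Type*} [TopologicalSpace M] [ChartedSpace HM M]
variable
  {XD' : Type*} [NormedAddCommGroup XD'] [NormedSpace ℝ XD'] {HD' : Type*} [TopologicalSpace HD']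
  {ID' : ModelWithCorners ℝ XD' HD'} {D' : Type*} [TopologicalSpace D'] [ChartedSpace HD' D']
  {XA' : Type*} [NormedAddCommGroup XA'] [NormedSpace ℝ XA'] {HA' : Type*} [TopologicalSpace HA']
  {IA' : ModelWithCorners ℝ XA' HA'} {A' : Type*} [TopologicalSpace A'] [ChartedSpace HA' A']
  {XB' : Type*} [NormedAddCommGroup XB'] [NormedSpace ℝ XB'] {HB' : Type*} [TopologicalSpace HB']
  {IB' : ModelWithCorners ℝ XB' HB'} {B' : Type*} [TopologicalSpace B'] [ChartedSpace HB' B']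
  {XM' : Type*} [NormedAddCommGroup XM'] [NormedSpace ℝ XM'] {HM' : Type*} [TopologicalSpace HM']
  {IM' : ModelWithCorners ℝ XM' HM'} {M' : Type*} [TopologicalSpace M'] [ChartedSpace HM' M']


theorem IsDoubleVectorBundle.flip {S : VBSquare ID D IA A IB B IM M}
    (hS : S.IsDoubleVectorBundle) : S.flip.IsDoubleVectorBundle where
  isVectorBundle_DA := hS.isVectorBundle_DB
  isVectorBundle_DB := hS.isVectorBundle_DA
  isVectorBundle_A := hS.isVectorBundle_B
  isVectorBundle_B := hS.isVectorBundle_A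
  isHom_projB := hS.isHom_projA
  isHom_projA := hS.isHom_projB
  isHom_zeroA := hS.isHom_zeroB
  isHom_zeroB := hS.isHom_zeroA
  add_add d₁ d₂ d₃ d₄ h12 h34 h13 h24 := (hS.add_add d₁ d₃ d₂ d₄ h13 h24 h12 h34).symm
  smulA_addB := hS.smulB_addA
  smulB_addA := hS.smulA_addB
  smul_smul s t d := (hS.smul_smul t s d).symm
  surjective a b h := by
    obtain ⟨d, h1, h2⟩ := hS.surjective b a h.symm
    exact ⟨d, h2, h1⟩
  submersion d α β hα hβ h := by
    obtain ⟨δ, h0, h1, h2⟩ := hS.submersion d β α hβ hα h.symm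
    exact ⟨δ, h0, h2, h1⟩

/-- A square of vector bundles that is isomorphic to a double vector bundle is a double vector
bundle. -/
theorem IsDoubleVectorBundle.of_isHom {S : VBSquare ID D IA A IB B IM M}
    {S' : VBSquare ID' D' IA' A' IB' B' IM' M'} (hS' : S'.IsDoubleVectorBundle)
    (hDA : S.vDA.IsVectorBundle) (hDB : S.vDB.IsVectorBundle)
    (hA : S.vA.IsVectorBundle) (hB : S.vB.IsVectorBundle)
    {f : D → D'} {fA : A → A'} {fB : B → B'} {fM : M → M'}
    {g : D' → D} {gA : A' → A} {gB : B' → B} {gM : M' → M}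
    (hf : IsHom S S' f fA fB fM) (hg : IsHom S' S g gA gB gM)
    (hD : Function.LeftInverse g f) (hgA : Function.LeftInverse gA fA)
    (hgB : Function.LeftInverse gB fB) (hgM : Function.LeftInverse gM fM) :
    S.IsDoubleVectorBundle := by
  have pA : S.vDA.proj = gA ∘ S'.vDA.proj ∘ f := by
    funext d; simp [hf.isHom_DA.map_proj, hgA _]
  have pB : S.vDB.proj = gB ∘ S'.vDB.proj ∘ f := by
    funext d; simp [hf.isHom_DB.map_proj, hgB _]
  have qA : S.vA.proj = gM ∘ S'.vA.proj ∘ fA := by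
    funext d; simp [hf.isHom_A.map_proj, hgM _]
  have qB : S.vB.proj = gM ∘ S'.vB.proj ∘ fB := by
    funext d; simp [hf.isHom_B.map_proj, hgM _]
  have zA : S.vDA.zero = g ∘ S'.vDA.zero ∘ fA := by
    funext d; simp [hg.isHom_DA.map_zero, hgA _]
  have zB : S.vDB.zero = g ∘ S'.vDB.zero ∘ fB := by
    funext d; simp [hg.isHom_DB.map_zero, hgB _]
  have wA : S.vA.zero = gA ∘ S'.vA.zero ∘ fM := by
    funext d; simp [hg.isHom_A.map_zero, hgM _]
  have wB : S.vB.zero = gB ∘ S'.vB.zero ∘ fM := by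
    funext d; simp [hg.isHom_B.map_zero, hgM _]
  have mA : ∀ {d d'}, S.vDA.proj d = S.vDA.proj d' → S'.vDA.proj (f d) = S'.vDA.proj (f d') :=
    fun h ↦ by rw [hf.isHom_DA.map_proj, hf.isHom_DA.map_proj, h]
  have mB : ∀ {d d'}, S.vDB.proj d = S.vDB.proj d' → S'.vDB.proj (f d) = S'.vDB.proj (f d') :=
    fun h ↦ by rw [hf.isHom_DB.map_proj, hf.isHom_DB.map_proj, h]
  -- The sums that enter the interchange laws are composable.
  have aAB : ∀ {d₁ d₂ d₃ d₄}, S.vDA.proj d₁ = S.vDA.proj d₂ → S.vDA.proj d₃ = S.vDA.proj d₄ →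
      S.vDB.proj d₁ = S.vDB.proj d₃ → S.vDB.proj d₂ = S.vDB.proj d₄ →
      S.vDB.proj (S.vDA.add d₁ d₂) = S.vDB.proj (S.vDA.add d₃ d₄) := by
    intro d₁ d₂ d₃ d₄ h12 h34 h13 h24
    have e := fun {d d'} (h : S.vDA.proj d = S.vDA.proj d') ↦
      (hS'.isHom_projB.map_add (f d) (f d') (mA h))
    rw [pB]
    simp only [Function.comp_apply]
    rw [hf.isHom_DA.map_add _ _ h12, hf.isHom_DA.map_add _ _ h34, e h12, e h34, mB h13, mB h24]
  have aBA : ∀ {d₁ d₂ d₃ d₄}, S.vDB.proj d₁ = S.vDB.proj d₂ → S.vDB.proj d₃ = S.vDB.proj d₄ →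
      S.vDA.proj d₁ = S.vDA.proj d₃ → S.vDA.proj d₂ = S.vDA.proj d₄ →
      S.vDA.proj (S.vDB.add d₁ d₂) = S.vDA.proj (S.vDB.add d₃ d₄) := by
    intro d₁ d₂ d₃ d₄ h12 h34 h13 h24
    have e := fun {d d'} (h : S.vDB.proj d = S.vDB.proj d') ↦
      (hS'.isHom_projA.map_add (f d) (f d') (mB h))
    rw [pA]
    simp only [Function.comp_apply]
    rw [hf.isHom_DB.map_add _ _ h12, hf.isHom_DB.map_add _ _ h34, e h12, e h34, mA h13, mA h24]
  have sA : ∀ (t : ℝ) {d d'}, S.vDB.proj d = S.vDB.proj d' →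
      S.vDB.proj (S.vDA.smul t d) = S.vDB.proj (S.vDA.smul t d') := by
    intro t d d' h
    rw [pB]
    simp only [Function.comp_apply]
    rw [hf.isHom_DA.map_smul, hf.isHom_DA.map_smul, hS'.isHom_projB.map_smul,
      hS'.isHom_projB.map_smul, mB h]
  have sB : ∀ (t : ℝ) {d d'}, S.vDA.proj d = S.vDA.proj d' →
      S.vDA.proj (S.vDB.smul t d) = S.vDA.proj (S.vDB.smul t d') := by
    intro t d d' h
    rw [pA]
    simp only [Function.comp_apply]
    rw [hf.isHom_DB.map_smul, hf.isHom_DB.map_smul, hS'.isHom_projA.map_smul,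
      hS'.isHom_projA.map_smul, mA h]
  constructor
  · exact hDA
  · exact hDB
  · exact hA
  · exact hB
  · rw [pB, qA]
    exact hg.isHom_B.comp (hS'.isHom_projB.comp hf.isHom_DA)
  · rw [pA, qB]
    exact hg.isHom_A.comp (hS'.isHom_projA.comp hf.isHom_DB)
  · rw [zA, wB]
    exact hg.isHom_DB.comp (hS'.isHom_zeroA.comp hf.isHom_A)
  · rw [zB, wA]
    exact hg.isHom_DA.comp (hS'.isHom_zeroB.comp hf.isHom_B)
  · intro d₁ d₂ d₃ d₄ h12 h34 h13 h24
    apply hD.injective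
    rw [hf.isHom_DB.map_add _ _ (aAB h12 h34 h13 h24), hf.isHom_DA.map_add _ _ h12,
      hf.isHom_DA.map_add _ _ h34, hf.isHom_DA.map_add _ _ (aBA h13 h24 h12 h34),
      hf.isHom_DB.map_add _ _ h13, hf.isHom_DB.map_add _ _ h24]
    exact hS'.add_add _ _ _ _ (mA h12) (mA h34) (mB h13) (mB h24)
  · intro t d d' h
    apply hD.injective
    rw [hf.isHom_DA.map_smul, hf.isHom_DB.map_add _ _ h, hf.isHom_DB.map_add _ _ (sA t h),
      hf.isHom_DA.map_smul, hf.isHom_DA.map_smul]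
    exact hS'.smulA_addB t _ _ (mB h)
  · intro t d d' h
    apply hD.injective
    rw [hf.isHom_DB.map_smul, hf.isHom_DA.map_add _ _ h, hf.isHom_DA.map_add _ _ (sB t h),
      hf.isHom_DB.map_smul, hf.isHom_DB.map_smul]
    exact hS'.smulB_addA t _ _ (mA h)
  · intro s t d
    apply hD.injective
    rw [hf.isHom_DA.map_smul, hf.isHom_DB.map_smul, hf.isHom_DB.map_smul, hf.isHom_DA.map_smul]
    exact hS'.smul_smul s t _
  · intro a b hab
    obtain ⟨d, h1, h2⟩ := hS'.surjective (fA a) (fB b)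
      (by rw [hf.isHom_A.map_proj, hf.isHom_B.map_proj, hab])
    exact ⟨g d, by rw [hg.isHom_DA.map_proj, h1, hgA], by rw [hg.isHom_DB.map_proj, h2, hgB]⟩
  · intro d α β hα hβ hαβ
    obtain ⟨δ, h0, h1, h2⟩ := hS'.submersion (f d) (tangentMap IA IA' fA α) (tangentMap IB IB' fB β)
      (by rw [tangentMap_fst, hα, hf.isHom_DA.map_proj])
      (by rw [tangentMap_fst, hβ, hf.isHom_DB.map_proj]) (by
        rw [tangentMap_comm hS'.isVectorBundle_A.contMDiff_proj hf.isHom_A.contMDiff_total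
          hf.isHom_A.contMDiff_base hA.contMDiff_proj hf.isHom_A.map_proj, hαβ,
          tangentMap_comm hS'.isVectorBundle_B.contMDiff_proj hf.isHom_B.contMDiff_total
          hf.isHom_B.contMDiff_base hB.contMDiff_proj hf.isHom_B.map_proj])
    refine ⟨tangentMap ID' ID g δ, ?_, ?_, ?_⟩
    · rw [tangentMap_fst, h0, hD]
    · rw [tangentMap_comm hDA.contMDiff_proj hg.isHom_DA.contMDiff_total hg.isHom_DA.contMDiff_base
        hS'.isVectorBundle_DA.contMDiff_proj hg.isHom_DA.map_proj, h1]
      exact tangentMap_leftInverse hg.isHom_DA.contMDiff_base hf.isHom_DA.contMDiff_base hgA α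
    · rw [tangentMap_comm hDB.contMDiff_proj hg.isHom_DB.contMDiff_total hg.isHom_DB.contMDiff_base
        hS'.isVectorBundle_DB.contMDiff_proj hg.isHom_DB.map_proj, h2]
      exact tangentMap_leftInverse hg.isHom_DB.contMDiff_base hf.isHom_DB.contMDiff_base hgB β

end Transport

end VBSquare

/-! ### The core, and the cube -/

section Core

variable
  {X : Type*} [NormedAddCommGroup X] [NormedSpace ℝ X] {H : Type*} [TopologicalSpace H]
  {I : ModelWithCorners ℝ X H} {N : Type*} [TopologicalSpace N] [ChartedSpace H N]
  [IsManifold I ∞ N]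

open VBStr

/-- In coordinates the vector `ξ̄` of `ξ = (x, a)` is `(x, 0; 0, a)`. -/
theorem coreLift_eq (ξ : TangentBundle I N) :
    coreLift I N ξ = ⟨⟨ξ.proj, (0 : X)⟩, ((0, ξ.vec) : X × X)⟩ := by
  have hT := isTrivialization_tangentBundle (I := I) ξ.proj
  have hξ : ξ.proj ∈ (chartAt H ξ.proj).source := mem_chart_source H _
  have h0 : (tangentBundle I N).smul 0 ξ = ⟨ξ.proj, (0 : X)⟩ :=
    TangentBundle.ext_vec rfl (zero_smul ℝ ξ.vec)
  have hc : MDifferentiableAt 𝓘(ℝ, ℝ) I.tangent (fun t : ℝ ↦ (tangentBundle I N).smul t ξ) 0 := by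
    have h1 : ContMDiffAt 𝓘(ℝ, ℝ) (I.prod 𝓘(ℝ, X)) ∞
        (fun t : ℝ ↦ (ξ.proj, t • (trivializationAt X (TangentSpace I) ξ.proj ξ).2)) 0 :=
      contMDiffAt_const.prodMk (contDiff_id.smul contDiff_const).contMDiff.contMDiffAt
    have h2 := (hT.contMDiffAt_symm (p := (ξ.proj,
      (0 : ℝ) • (trivializationAt X (TangentSpace I) ξ.proj ξ).2)) hξ).comp 0 h1
    refine (h2.congr_of_eventuallyEq (Filter.Eventually.of_forall fun t ↦ ?_)).mdifferentiableAt
      (by simp)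
    have h3 := hT.symm_apply ((tangentBundle I N).smul t ξ) hξ
    rw [hT.fibre_smul t ξ hξ] at h3
    exact h3.symm
  refine TangentBundle.ext_vec h0 (eq_of_mderiv_trivializationAt (x := ξ.proj)
    (p := (tangentBundle I N).smul 0 ξ) rfl ?_ ?_)
  · refine (mderiv_comp (f := fun t : ℝ ↦ (tangentBundle I N).smul t ξ)
      (hT.mdifferentiableAt_proj _) hc (1 : ℝ)).symm.trans ?_
    exact congrArg (fun L : ℝ →L[ℝ] X ↦ L 1) (mderiv_const (I := 𝓘(ℝ, ℝ)) (I' := I) ξ.proj (0 : ℝ))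
  · refine (mderiv_comp (f := fun t : ℝ ↦ (tangentBundle I N).smul t ξ)
      (hT.mdifferentiableAt_fibre (d := (tangentBundle I N).smul 0 ξ) hξ) hc (1 : ℝ)).symm.trans ?_
    rw [funext fun t ↦ hT.fibre_smul t ξ hξ, snd_trivializationAt_self]
    refine (mderiv_clm (f := fun t : ℝ ↦ t) mdifferentiableAt_id
      (ContinuousLinearMap.toSpanSingleton ℝ ξ.vec) 1).trans ?_
    simp

/-- The core of the square formed by `p_{TN}` and `T(p_N)` consists of the vectors
`(x, 0; 0, c)`. -/
theorem mem_core_prolongationSquare {ζ : TangentBundle I.tangent (TangentBundle I N)} :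
    ζ ∈ (tangentBundle I N).prolongationSquare.core ↔ ζ.proj.vec = 0 ∧ ζ.vec.1 = 0 := by
  constructor
  · rintro ⟨x, h1, h2⟩
    have e1 : ζ.proj.vec = 0 := by
      have : ζ.proj = (tangentBundle I N).zero x := h1
      rw [this]
      rfl
    have e2 := congrArg TangentBundle.vec h2
    exact ⟨e1, (mderiv_tangentBundle_proj ζ.proj ζ.vec).symm.trans e2⟩
  · rintro ⟨h1, h2⟩
    exact ⟨ζ.proj.proj, TangentBundle.ext_vec rfl h1,
      TangentBundle.ext_vec rfl ((mderiv_tangentBundle_proj ζ.proj ζ.vec).trans h2)⟩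

theorem bijOn_coreLift :
    BijOn (coreLift I N) univ (tangentBundle I N).prolongationSquare.core := by
  refine ⟨fun ξ _ ↦ ?_, fun ξ _ ξ' _ h ↦ ?_, fun ζ hζ ↦ ?_⟩
  · rw [mem_core_prolongationSquare, coreLift_eq]
    exact ⟨rfl, rfl⟩
  · rw [coreLift_eq, coreLift_eq] at h
    exact TangentBundle.ext_vec (congrArg (fun ζ ↦ ζ.proj.proj) h)
      (congrArg (fun ζ : TangentBundle I.tangent (TangentBundle I N) ↦ ζ.vec.2) h)
  · obtain ⟨h1, h2⟩ := mem_core_prolongationSquare.1 hζ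
    refine ⟨⟨ζ.proj.proj, ζ.vec.2⟩, mem_univ _, ?_⟩
    rw [coreLift_eq]
    exact TangentBundle.ext_vec (TangentBundle.ext_vec rfl h1.symm) (Prod.ext h2.symm rfl)

theorem canonicalInvolution_of_mem_core {ζ : TangentBundle I.tangent (TangentBundle I N)}
    (hζ : ζ ∈ (tangentBundle I N).prolongationSquare.core) : canonicalInvolution I N ζ = ζ := by
  obtain ⟨h1, h2⟩ := mem_core_prolongationSquare.1 hζ
  exact TangentBundle.ext_vec (TangentBundle.ext_vec rfl (h2.trans h1.symm))
    (Prod.ext (h1.trans h2.symm) rfl)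

end Core

theorem inverse_id {T : Type*} :
    Function.LeftInverse (id : T → T) id ∧ Function.RightInverse (id : T → T) id :=
  ⟨fun _ ↦ rfl, fun _ ↦ rfl⟩

end

theorem proposition5p1 {X : Type*} [NormedAddCommGroup X] [NormedSpace ℝ X] [FiniteDimensional ℝ X]
    {H : Type*} [TopologicalSpace H] (I : ModelWithCorners ℝ X H) [I.Boundaryless]
    {M : Type*} [TopologicalSpace M] [ChartedSpace H M] [IsManifold I ∞ M]
    (F : Type*) [NormedAddCommGroup F] [NormedSpace ℝ F] [FiniteDimensional ℝ F]
    (V : M → Type*) [TopologicalSpace (TotalSpace F V)] [∀ x, AddCommGroup (V x)]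
    [∀ x, Module ℝ (V x)] [∀ x, TopologicalSpace (V x)] [FiberBundle F V] [VectorBundle ℝ F V]
    [ContMDiffVectorBundle ∞ F V I] :
    -- the faces of the cube `T²A` and of its flip are double vector bundles
    (doubleTangentCube I F V).FacesAreDoubleVectorBundles ∧
    (doubleTangentCube I F V).flip.FacesAreDoubleVectorBundles ∧
    -- `J_A` is an isomorphism of triple vector bundles onto the flip, over `J_M` on `T²M` and over
    -- the identity maps of `TA`, `TM`, `A` and `M`
    VBCube.IsIso (doubleTangentCube I F V) (doubleTangentCube I F V).flip
      (canonicalInvolution (I.prod 𝓘(ℝ, F)) (TotalSpace F V)) id (canonicalInvolution I M) id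
      id id id id ∧
    -- the Up and the Back face are interchanged
    VBSquare.IsIso (doubleTangentCube I F V).up (doubleTangentCube I F V).back
      (canonicalInvolution (I.prod 𝓘(ℝ, F)) (TotalSpace F V)) id (canonicalInvolution I M) id ∧
    VBSquare.IsIso (doubleTangentCube I F V).back (doubleTangentCube I F V).up
      (canonicalInvolution (I.prod 𝓘(ℝ, F)) (TotalSpace F V)) id (canonicalInvolution I M) id ∧
    -- the Front and the Down face are interchanged
    VBSquare.IsIso (doubleTangentCube I F V).front (doubleTangentCube I F V).down id id id id ∧
    VBSquare.IsIso (doubleTangentCube I F V).down (doubleTangentCube I F V).front id id id id ∧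
    -- the Left and the Right face are mapped to their flips
    VBSquare.IsIso (doubleTangentCube I F V).left (doubleTangentCube I F V).left.flip
      (canonicalInvolution (I.prod 𝓘(ℝ, F)) (TotalSpace F V)) id id id ∧
    VBSquare.IsIso (doubleTangentCube I F V).right (doubleTangentCube I F V).right.flip
      (canonicalInvolution I M) id id id ∧
    -- `ξ ↦ ξ̄` identifies `TA` with the core of the Left face, on which `J_A` is the identity
    BijOn (coreLift (I.prod 𝓘(ℝ, F)) (TotalSpace F V)) univ (doubleTangentCube I F V).left.core ∧
    (∀ v ∈ (doubleTangentCube I F V).left.core,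
      canonicalInvolution (I.prod 𝓘(ℝ, F)) (TotalSpace F V) v = v) := by
  have hq : (VBStr.ofBundle I F V).IsVectorBundle := VBStr.isVectorBundle_ofBundle
  have hTA : (VBStr.tangentBundle (I.prod 𝓘(ℝ, F)) (TotalSpace F V)).IsVectorBundle :=
    VBStr.isVectorBundle_ofBundle
  have hTM : (VBStr.tangentBundle I M).IsVectorBundle := VBStr.isVectorBundle_ofBundle
  have hJA := canonicalInvolution_canonicalInvolution (I := I.prod 𝓘(ℝ, F)) (N := TotalSpace F V)
  have hJM := canonicalInvolution_canonicalInvolution (I := I) (N := M)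
  -- The edges of the cube on which the involutions are not the identity.
  have a₁ := isHom_canonicalInvolution (I := I.prod 𝓘(ℝ, F)) (N := TotalSpace F V)
  have a₂ := isHom_canonicalInvolution_symm (I := I.prod 𝓘(ℝ, F)) (N := TotalSpace F V)
  have a₃ := hq.isHom_tangent_tangent
  have b₁ := isHom_canonicalInvolution (I := I) (N := M)
  have b₂ := isHom_canonicalInvolution_symm (I := I) (N := M)
  have iTA := VBStr.IsHom.id (VBStr.tangentBundle (I.prod 𝓘(ℝ, F)) (TotalSpace F V))
  have iTq := VBStr.IsHom.id (VBStr.ofBundle I F V).tangent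
  have iTM := VBStr.IsHom.id (VBStr.tangentBundle I M)
  have iq := VBStr.IsHom.id (VBStr.ofBundle I F V)
  have down : (doubleTangentCube I F V).down.IsDoubleVectorBundle :=
    hq.isDoubleVectorBundle_prolongationSquare
  have back : (doubleTangentCube I F V).back.IsDoubleVectorBundle :=
    hq.tangent.isDoubleVectorBundle_prolongationSquare
  have left : (doubleTangentCube I F V).left.IsDoubleVectorBundle :=
    hTA.isDoubleVectorBundle_prolongationSquare
  have right : (doubleTangentCube I F V).right.IsDoubleVectorBundle :=
    hTM.isDoubleVectorBundle_prolongationSquare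
  have upBack : VBSquare.IsHom (doubleTangentCube I F V).up (doubleTangentCube I F V).back
      (canonicalInvolution (I.prod 𝓘(ℝ, F)) (TotalSpace F V)) id (canonicalInvolution I M) id :=
    ⟨a₂, a₃, iTq, b₂⟩
  have backUp : VBSquare.IsHom (doubleTangentCube I F V).back (doubleTangentCube I F V).up
      (canonicalInvolution (I.prod 𝓘(ℝ, F)) (TotalSpace F V)) id (canonicalInvolution I M) id :=
    ⟨a₁, a₃, iTq, b₁⟩
  have up : (doubleTangentCube I F V).up.IsDoubleVectorBundle :=
    back.of_isHom hTA.tangent hq.tangent.tangent hq.tangent hTM.tangent upBack backUp hJA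
      (fun _ ↦ rfl) hJM (fun _ ↦ rfl)
  refine ⟨⟨up, down, back, down, left, right⟩, ⟨back, down, up, down, left.flip, right.flip⟩,
    ⟨⟨a₁, a₃, a₂, iTq, iTA, b₁, b₂, iTA, iTq, iTM, iq, iTM⟩, _, id, _, id, id, id, id, id,
      ⟨a₂, a₃, a₁, iTq, iTA, b₂, b₁, iTA, iTq, iTM, iq, iTM⟩, ⟨hJA, hJA⟩, inverse_id,
      ⟨hJM, hJM⟩, inverse_id, inverse_id, inverse_id, inverse_id, inverse_id⟩,
    ⟨upBack, _, _, _, _, backUp, ⟨hJA, hJA⟩, inverse_id, ⟨hJM, hJM⟩, inverse_id⟩,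
    ⟨backUp, _, _, _, _, upBack, ⟨hJA, hJA⟩, inverse_id, ⟨hJM, hJM⟩, inverse_id⟩,
    ⟨⟨iTA, iTq, iq, iTM⟩, _, _, _, _, ⟨iTA, iTq, iq, iTM⟩, inverse_id,
      inverse_id, inverse_id, inverse_id⟩,
    ⟨⟨iTA, iTq, iq, iTM⟩, _, _, _, _, ⟨iTA, iTq, iq, iTM⟩, inverse_id,
      inverse_id, inverse_id, inverse_id⟩,
    ⟨⟨a₁, a₂, iTA, iTA⟩, _, _, _, _, ⟨a₂, a₁, iTA, iTA⟩, ⟨hJA, hJA⟩, inverse_id,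
      inverse_id, inverse_id⟩,
    ⟨⟨b₁, b₂, iTM, iTM⟩, _, _, _, _, ⟨b₂, b₁, iTM, iTM⟩, ⟨hJM, hJM⟩, inverse_id,
      inverse_id, inverse_id⟩,
    bijOn_coreLift, fun ζ hζ ↦ canonicalInvolution_of_mem_core hζ⟩
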